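/- All groups are finite. A formation is a class of groups closed under homomorphic images and such that $G/M, G/N\in\mathfrak X$ implies $G/(M\cap N)\in\mathfrak X$. Let $\mathbb P$ be the set of primes. A composition definition is a function $f$ from $\mathbb P\cup\{0\}$ to formations; a formation $\mathfrak F$ is a composition (equivalently, solubly saturated) formation if for some such $f$ it is the class of all groups $G$ with $G/G_{\mathfrak S}\in f(0)$, where $G_{\mathfrak S}$ is the soluble radical, and $G/C_G(\overline H)\in f(p)$ for every prime $p$ and every abelian $p$-chief factor $\overline H$ of $G$. Its canonical composition definition $F$ is the unique such $f$ with $f(0)=\mathfrak F$ and $f(p)=\mathfrak N_pf(p)\subseteq\mathfrak F$ for all primes $p$, where $\mathfrak N_p\mathfrak X=(G \mid G/O_p(G)\in\mathfrak X)$. A generalized rank function $\mathcal R$ assigns to each simple group $S$ a pair $\mathcal R(S)=(A_{\mathcal R}(S),B_{\mathcal R}(S))$ of disjoint, possibly empty, sets of natural numbers, and satisfies $\mathcal R(N)=\mathcal R(S)$ whenever $N$ is a direct product of (one or more) groups isomorphic to $S$. The rank $r(\overline H,G)$ of a chief factor $\overline H$ of $G$ is the number of simple direct factors in a decomposition of $\overline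 H$ as a direct product of isomorphic simple groups. One writes $gr(\overline H,G)\in\mathcal R(\overline H)$ if either $r(\overline H,G)\in A_{\mathcal R}(\overline H)$, or $r(\overline H,G)\in B_{\mathcal R}(\overline H)$ and whenever $x\in G$ fixes a composition factor $U/V$ of $\overline H$ (that is, $U^x=U$ and $V^x=V$), $x$ induces an inner automorphism on $U/V$. A chief factor $\overline H$ is $\mathfrak X$-central in $G$ if $\overline H\rtimes G/C_G(\overline H)\in\mathfrak X$, and $\mathfrak X$-eccentric otherwise. Let $\mathfrak X(\mathcal R)$ be the class of all groups $G$ such that every $\mathfrak X$-eccentric chief factor $\overline H$ of $G$ satisfies $\overline H\notin\mathfrak X$ and $gr(\overline H,G)\in\mathcal R(\overline H)$. The function $\mathcal R$ is good if for every simple group $S$ and all natural numbers $b\mid a$: $a\in A_{\mathcal R}(S)$ implies $b\in A_{\mathcal R}(S)$, and $a\in B_{\mathcal R}(S)$ implies $b\in A_{\mathcal R}(S)\cup B_{\mathcal R}(S)$. A class is normally hereditary if it contains all normal subgroups of its members. Theorem. Let $\mathfrak F$ be a composition formation containing all nilpotent groups, with canonical composition definition $F$, and let $\mathcal R$ be a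 generalized rank function. (1) $\mathfrak F(\mathcal R)$ is a composition formation, and its canonical composition definition $F_{\mathcal R}$ is given by $F_{\mathcal R}(0)=\mathfrak F(\mathcal R)$ and $F_{\mathcal R}(p)=F(p)$ for all primes $p$. (2) If $\mathfrak F$ is normally hereditary and $\mathcal R$ is good, then $\mathfrak F(\mathcal R)$ is normally hereditary. -/

import Mathlib

universe u

namespace CompositionFormation

/-! ### Classes of groups and formations -/

/-- A class of groups (in a fixed universe), given by its membership predicate. -/
abbrev GroupClass : Type (u + 1) := (G : Type u) → [Group G] → Prop

/-- Inclusion of classes of groups. -/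
def GroupClass.Subclass (X Y : GroupClass.{u}) : Prop :=
  ∀ (G : Type u) [Group G], X G → Y G

/-- A formation: a class of finite groups which is closed under homomorphic images (in particular
under isomorphisms) and such that `G / M, G / N ∈ X` implies `G / (M ∩ N) ∈ X`. -/
structure IsFormation (X : GroupClass.{u}) : Prop where
  finite : ∀ (G : Type u) [Group G], X G → Finite G
  image : ∀ (G H : Type u) [Group G] [Group H] (f : G →* H),
    Function.Surjective f → X G → X H
  inf : ∀ (G : Type u) [Group G] [Finite G] (M N : Subgroup G) [M.Normal] [N.Normal],
    X (G ⧸ M) → X (G ⧸ N) → X (G ⧸ (M ⊓ N))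

/-- The class of all finite nilpotent groups. -/
def nilpotentGroups : GroupClass.{u} := fun G _ => Finite G ∧ Group.IsNilpotent G

/-- A class is normally hereditary if it contains the normal subgroups of its members. -/
def IsNormallyHereditary (X : GroupClass.{u}) : Prop :=
  ∀ (G : Type u) [Group G] (N : Subgroup G), N.Normal → X G → X N

/-! ### Radicals -/

/-- The soluble radical: the subgroup generated by all soluble normal subgroups. -/
def solubleRadical (G : Type u) [Group G] : Subgroup G :=
  sSup {N : Subgroup G | N.Normal ∧ Group.IsSolvable N}

/-- `O_p(G)`: the subgroup generated by all normal `p`-subgroups. -/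
def pCore (p : ℕ) (G : Type u) [Group G] : Subgroup G :=
  sSup {N : Subgroup G | N.Normal ∧ IsPGroup p N}

theorem sSup_normal_of_forall {G : Type u} [Group G] (s : Set (Subgroup G))
    (hs : ∀ N ∈ s, N.Normal) : (sSup s).Normal := by
  rw [sSup_eq_iSup']
  have hn : ∀ N : s, (N : Subgroup G).Normal := fun N => hs N N.2
  infer_instance

instance solubleRadical_normal (G : Type u) [Group G] : (solubleRadical G).Normal :=
  sSup_normal_of_forall _ fun _ h => h.1

instance pCore_normal (p : ℕ) (G : Type u) [Group G] : (pCore p G).Normal :=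
  sSup_normal_of_forall _ fun _ h => h.1

/-- The class `𝔑_p X` of all finite groups `G` with `G / O_p(G) ∈ X`. -/
def pGroupsBy (p : ℕ) (X : GroupClass.{u}) : GroupClass.{u} :=
  fun G _ => Finite G ∧ X (G ⧸ pCore p G)

/-! ### Chief factors -/

/-- A chief factor `top / bot` of `G`. -/
structure ChiefFactor (G : Type u) [Group G] where
  top : Subgroup G
  bot : Subgroup G
  top_normal : top.Normal
  bot_normal : bot.Normal
  lt : bot < top
  eq_or_eq : ∀ L : Subgroup G, L.Normal → bot ≤ L → L ≤ top → L = bot ∨ L = top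

attribute [instance] ChiefFactor.top_normal ChiefFactor.bot_normal

namespace ChiefFactor

variable {G : Type u} [Group G]

/-- The chief factor as a group. -/
abbrev Carrier (c : ChiefFactor G) : Type u := c.top ⧸ c.bot.subgroupOf c.top

theorem map_conj (c : ChiefFactor G) (g : G) :
    (c.bot.subgroupOf c.top).map
      ((MulAut.conjNormal g : MulAut c.top) : c.top →* c.top) = c.bot.subgroupOf c.top := by
  have key : ∀ g : G, (c.bot.subgroupOf c.top).map
      ((MulAut.conjNormal g : MulAut c.top) : c.top →* c.top) ≤ c.bot.subgroupOf c.top := by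
    rintro g _ ⟨x, hx, rfl⟩
    rw [SetLike.mem_coe, Subgroup.mem_subgroupOf] at hx
    rw [Subgroup.mem_subgroupOf]
    simpa using c.bot_normal.conj_mem _ hx g
  refine le_antisymm (key g) fun x hx => ?_
  refine ⟨(MulAut.conjNormal g⁻¹ : MulAut c.top) x, key g⁻¹ ⟨x, hx, rfl⟩, ?_⟩
  apply Subtype.ext
  simp

/-- The conjugation action of `G` on a chief factor. -/
def action (c : ChiefFactor G) : G →* MulAut c.Carrier where
  toFun g := QuotientGroup.congr _ _ (MulAut.conjNormal g) (c.map_conj g)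
  map_one' := by
    ext ⟨x⟩
    simp
    rfl
  map_mul' g h := by
    ext ⟨x⟩
    change ((MulAut.conjNormal (g * h) x : c.top) : c.Carrier) =
      ((MulAut.conjNormal g (MulAut.conjNormal h x) : c.top) : c.Carrier)
    rw [map_mul, MulAut.mul_apply]

theorem action_mk (c : ChiefFactor G) (g : G) (x : c.top) :
    c.action g (x : c.Carrier) = ((MulAut.conjNormal g x : c.top) : c.Carrier) := rfl

/-- The centralizer `C_G(H/K)` of a chief factor. -/
abbrev centralizer (c : ChiefFactor G) : Subgroup G := c.action.ker

/-- The semidirect product `(H/K) ⋊ G / C_G(H/K)` with the action induced by conjugation. -/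
abbrev SemidirectProd (c : ChiefFactor G) : Type u :=
  c.Carrier ⋊[QuotientGroup.kerLift c.action] (G ⧸ c.centralizer)

/-- `X`-central chief factors; a chief factor that is not `X`-central is `X`-eccentric. -/
def IsCentral (X : GroupClass.{u}) (c : ChiefFactor G) : Prop := X c.SemidirectProd

/-- The chief factor is an abelian `p`-group. -/
def IsAbelianPFactor (p : ℕ) (c : ChiefFactor G) : Prop :=
  IsMulCommutative c.Carrier ∧ IsPGroup p c.Carrier

end ChiefFactor

/-! ### Composition formations -/

/-- A function on `{0} ∪ ℙ` with values in classes of groups. -/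
@[ext]
structure CompositionFunction where
  zero : GroupClass.{u}
  prime : Nat.Primes → GroupClass.{u}

/-- A composition definition: all values are formations. -/
def CompositionFunction.IsCompositionDefinition (f : CompositionFunction.{u}) : Prop :=
  IsFormation f.zero ∧ ∀ p, IsFormation (f.prime p)

/-- The class of all finite groups `G` with `G / G_𝔖 ∈ f(0)` and `G / C_G(H/K) ∈ f(p)` for every
abelian `p`-chief factor `H/K` of `G` and every prime `p`. -/
def CompositionFunction.clf (f : CompositionFunction.{u}) : GroupClass.{u} :=
  fun G _ => Finite G ∧ f.zero (G ⧸ solubleRadical G) ∧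
    ∀ (p : Nat.Primes) (c : ChiefFactor G), c.IsAbelianPFactor p → f.prime p (G ⧸ c.centralizer)

/-- Composition (Baer-local) formations. -/
def IsCompositionFormation (X : GroupClass.{u}) : Prop :=
  IsFormation X ∧ ∃ f : CompositionFunction.{u}, f.IsCompositionDefinition ∧ X = f.clf

/-- `F` is a canonical composition definition of `X`: it is a composition definition of `X` with
`F(p) = 𝔑_p F(p) ⊆ X` for all primes `p` and `F(0) = X`. -/
structure IsCanonicalDefinition (F : CompositionFunction.{u}) (X : GroupClass.{u}) : Prop where
  isCompositionDefinition : F.IsCompositionDefinition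
  eq_clf : X = F.clf
  prime_eq : ∀ p : Nat.Primes, F.prime p = pGroupsBy p (F.prime p)
  prime_subclass : ∀ p : Nat.Primes, (F.prime p).Subclass X
  zero_eq : F.zero = X

/-! ### Generalized rank functions -/

/-- `N` is isomorphic to the direct product of `n` copies of the simple group `S`. -/
def IsSimplePower (S : Type u) [Group S] (n : ℕ) (N : Type u) [Group N] : Prop :=
  IsSimpleGroup S ∧ Nonempty (N ≃* (Fin n → S))

/-- A generalized rank function: `N ↦ (A N, B N)`. Only its values at finite non-trivial direct
powers of simple groups matter. -/
structure GeneralizedRankFunction where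
  A : (N : Type u) → [Group N] → Set ℕ
  B : (N : Type u) → [Group N] → Set ℕ
  disjoint : ∀ (S : Type u) [Group S] [Finite S], IsSimpleGroup S → Disjoint (A S) (B S)
  eq_of_power : ∀ (S N : Type u) [Group S] [Finite S] [Group N] (n : ℕ), n ≠ 0 →
    IsSimplePower S n N → A N = A S ∧ B N = B S

/-- The rank of a chief factor: `H/K` is a direct product of `n` isomorphic simple groups. -/
def ChiefFactor.HasRank {G : Type u} [Group G] (c : ChiefFactor G) (n : ℕ) : Prop :=
  ∃ (S : Type u) (_ : Group S), IsSimplePower S n c.Carrier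

/-- `H / K` is a composition factor of the group `N`. -/
structure IsCompositionFactor {N : Type u} [Group N] (H K : Subgroup N) : Prop where
  subnormal : H.IsSubnormal
  le : K ≤ H
  normal : (K.subgroupOf H).Normal
  simple : IsSimpleGroup (H ⧸ K.subgroupOf H)

/-- If `x ∈ G` fixes a composition factor `A / B` of the chief factor (that is, `A` and `B` are
`x`-invariant), then `x` induces an inner automorphism on `A / B`. -/
def ChiefFactor.InducesInner {G : Type u} [Group G] (c : ChiefFactor G) : Prop :=
  ∀ (x : G) (A B : Subgroup c.Carrier), IsCompositionFactor A B →
    A.map (c.action x).toMonoidHom = A → B.map (c.action x).toMonoidHom = B →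
      ∃ a ∈ A, ∀ y ∈ A, (a * y * a⁻¹)⁻¹ * c.action x y ∈ B

/-- The generalized rank of the chief factor lies in `R(H/K)`. -/
def ChiefFactor.GeneralizedRankIn {G : Type u} [Group G] (c : ChiefFactor G)
    (R : GeneralizedRankFunction.{u}) : Prop :=
  (∃ n ∈ R.A c.Carrier, c.HasRank n) ∨ ((∃ n ∈ R.B c.Carrier, c.HasRank n) ∧ c.InducesInner)

/-- The class `X(R)` of all finite groups `G` such that every `X`-eccentric chief factor of `G` is
not in `X` and has its generalized rank in `R`. -/
def GroupClass.withRank (X : GroupClass.{u}) (R : GeneralizedRankFunction.{u}) : GroupClass.{u} :=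
  fun G _ => Finite G ∧
    ∀ c : ChiefFactor G, ¬ c.IsCentral X → ¬ X c.Carrier ∧ c.GeneralizedRankIn R

/-- Good generalized rank functions. -/
def GeneralizedRankFunction.IsGood (R : GeneralizedRankFunction.{u}) : Prop :=
  ∀ (S : Type u) [Group S] [Finite S], IsSimpleGroup S →
    (∀ a ∈ R.A S, ∀ b : ℕ, b ∣ a → b ∈ R.A S) ∧
    (∀ a ∈ R.B S, ∀ b : ℕ, b ∣ a → b ∈ R.A S ∪ R.B S)

end CompositionFormation

/-!
The class `X(R)` imposes on each chief factor `H/K` of `G` a condition ("admissibility") that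
depends only on the group `H/K` together with the group of automorphisms of `H/K` induced by `G`.
Chief factors that agree in this respect are called similar here. If `T` is normal in `G`, a chief factor
`H/K` is similar to `HT/KT` or to `(H ∩ T)/(K ∩ T)`, according to whether `T` avoids or covers it;
this replaces the Jordan–Hölder theorem throughout.

*Formation.* A chief factor of `G` above `M ∩ N` is similar to one above `M`, or else to one inside
`M`, which `N` avoids, and then to one above `N`. So `X(R)` is a formation. It contains `X`, since
`H ⋊ G` for `H` normal in `G` is a subdirect product of two copies of `G`, by `(h, g) ↦ h * g` and
`(h, g) ↦ g` (`ChiefFactor.isCentral_of_mem`).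

*Composition definition.* For an abelian `p`-chief factor, centrality is equivalent to
`G / C_G(H/K) ∈ F(p)` (`IsCanonicalDefinition.isCentral_iff`), and the abelian groups lie in `X`, so
an admissible abelian chief factor is central. A non-abelian chief factor is avoided by the soluble
radical, hence similar to a chief factor of the quotient by it. Both facts together give
`withRank_eq_clf`. A canonical definition is determined by its class: `G ∈ F(p)` if and only if the
regular wreath product of the group of order `p` with `G` is in the class.

*Normal heredity.* A chief factor of `N`, normal in `G`, is similar to one that is a section of a
chief factor `H/K` of `G` with `H ≤ N`. If `H/K` is central, so are the chief factors of `N` in it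
(`ChiefFactor.LiesIn.isCentral`). If it is eccentric, it is a power `S ^ n` of a non-abelian simple
group `S ∉ X`. By a Clifford-type argument all chief factors of `N` in `H/K` are isomorphic, to a
normal subgroup of `S ^ n`, which is `S ^ k` for some `k`; comparing orders, `k` divides `n`, and
goodness of `R` applies. The condition on inner automorphisms passes to sections because
composition factors of a section lift to composition factors of `H/K`.
-/

namespace CompositionFormation

/-! ### Formations -/

section Formations

variable {X : GroupClass.{u}} {G H E : Type u} [Group G] [Group H] [Group E]

theorem IsFormation.mulEquiv (hX : IsFormation X) (e : G ≃* H) (h : X G) : X H :=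
  hX.image G H e.toMonoidHom e.surjective h

theorem IsFormation.quotient_of_le (hX : IsFormation X) {M N : Subgroup G} [M.Normal] [N.Normal]
    (h : M ≤ N) (hM : X (G ⧸ M)) : X (G ⧸ N) :=
  hX.image _ _ (QuotientGroup.map M N (MonoidHom.id G) h)
    (QuotientGroup.map_surjective_of_surjective _ _ _
      ((QuotientGroup.mk'_surjective N).comp Function.surjective_id) _) hM

theorem IsFormation.quotient_ker_iff (hX : IsFormation X) {f : G →* H} :
    X (G ⧸ f.ker) ↔ X f.range :=
  ⟨hX.mulEquiv (QuotientGroup.quotientKerEquivRange f),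
    hX.mulEquiv (QuotientGroup.quotientKerEquivRange f).symm⟩

theorem IsFormation.of_surjective_of_ker_le (hX : IsFormation X) {f : G →* H}
    (hf : Function.Surjective f) {M : Subgroup G} [M.Normal] (hM : M ≤ f.ker) (h : X (G ⧸ M)) :
    X H :=
  hX.mulEquiv (QuotientGroup.quotientKerEquivOfSurjective f hf) (hX.quotient_of_le hM h)

/-- Closure under subdirect products: `H` is a quotient of `G / (ker f₁ ∩ ker f₂)`, which is a
subdirect product of the ranges of `f₁` and `f₂`. -/
theorem IsFormation.subdirect (hX : IsFormation X) [Finite G] {f₁ f₂ : G →* E}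
    (h₁ : X f₁.range) (h₂ : X f₂.range) {f : G →* H} (hf : Function.Surjective f)
    (h : ∀ g, f₁ g = 1 → f₂ g = 1 → f g = 1) : X H :=
  hX.of_surjective_of_ker_le hf (M := f₁.ker ⊓ f₂.ker) (fun g hg => h g hg.1 hg.2)
    (hX.inf G _ _ (hX.quotient_ker_iff.2 h₁) (hX.quotient_ker_iff.2 h₂))

/-- The `X`-residual of a finite group that has some quotient in `X`. -/
theorem IsFormation.exists_residual (hX : IsFormation X) [Finite G]
    (h : ∃ M : Subgroup G, ∃ _ : M.Normal, X (G ⧸ M)) :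
    ∃ M : Subgroup G, ∃ _ : M.Normal, X (G ⧸ M) ∧
      ∀ (N : Subgroup G) [N.Normal], X (G ⧸ N) → M ≤ N := by
  obtain ⟨M, ⟨hM, hXM⟩, hmin⟩ := exists_minimal_of_wellFoundedLT
    (fun M : Subgroup G => ∃ _ : M.Normal, X (G ⧸ M)) h
  refine ⟨M, hM, hXM, fun N _ hN => ?_⟩
  exact (hmin ⟨inferInstance, hX.inf G M N hXM hN⟩ inf_le_left).trans inf_le_right

theorem IsFormation.pi (hX : IsFormation X) {ι : Type} [Finite ι] [Nonempty ι] (h : X G) :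
    X (ι → G) := by
  have := hX.finite G h
  have hq (i : ι) : X ((ι → G) ⧸ (Pi.evalMonoidHom (fun _ : ι => G) i).ker) :=
    hX.mulEquiv (QuotientGroup.quotientKerEquivOfSurjective _
      (Function.surjective_eval i)).symm h
  obtain ⟨M, _, hM, hmin⟩ := hX.exists_residual ⟨_, _, hq (Classical.arbitrary ι)⟩
  have hbot : M = ⊥ := by
    rw [eq_bot_iff]
    intro f hf
    rw [Subgroup.mem_bot]
    funext i
    exact hmin _ (hq i) hf
  subst hbot
  exact hX.mulEquiv QuotientGroup.quotientBot hM

end Formations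

/-! ### Sections of chief factors -/

namespace ChiefFactor

variable {G H : Type u} [Group G] [Group H]

@[ext]
theorem ext {c d : ChiefFactor G} (h₁ : c.top = d.top) (h₂ : c.bot = d.bot) : c = d := by
  cases c; cases d; simp_all

theorem action_eq_one_iff (c : ChiefFactor G) (g : G) :
    c.action g = 1 ↔ ∀ a ∈ c.top, a⁻¹ * (g * a * g⁻¹) ∈ c.bot := by
  constructor
  · intro h a ha
    have := c.action_mk g ⟨a, ha⟩
    rw [h, MulAut.one_apply, QuotientGroup.eq, Subgroup.mem_subgroupOf] at this
    simpa using this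
  · intro h
    ext ⟨a⟩
    change c.action g (a : c.Carrier) = (a : c.Carrier)
    rw [action_mk, eq_comm, QuotientGroup.eq, Subgroup.mem_subgroupOf]
    simpa using h a a.2

theorem mk_eq_one_iff (c : ChiefFactor G) (a : c.top) :
    (a : c.Carrier) = 1 ↔ (a : G) ∈ c.bot := by
  rw [QuotientGroup.eq_one_iff, Subgroup.mem_subgroupOf]

theorem mem_centralizer (c : ChiefFactor G) (g : G) :
    g ∈ c.centralizer ↔ ∀ a ∈ c.top, a⁻¹ * (g * a * g⁻¹) ∈ c.bot := by
  rw [MonoidHom.mem_ker, action_eq_one_iff]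

theorem bot_le_centralizer (c : ChiefFactor G) : c.bot ≤ c.centralizer := by
  intro g hg
  rw [mem_centralizer]
  intro a _
  have : a⁻¹ * (g * a * g⁻¹) = (a⁻¹ * g * a) * g⁻¹ := by group
  rw [this]
  exact mul_mem (by simpa using c.bot_normal.conj_mem g hg a⁻¹) (inv_mem hg)

instance (c : ChiefFactor G) : Nontrivial c.Carrier := by
  rw [QuotientGroup.nontrivial_iff]
  intro h
  rw [Subgroup.subgroupOf_eq_top] at h
  exact c.lt.not_ge h

/-- Two chief factors (of possibly different groups) are similar if there is an isomorphism
between them that carries the group of automorphisms induced on the first one onto the group of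
automorphisms induced on the second one. All the conditions on a chief factor considered here
depend only on its similarity class. -/
def Similar (c : ChiefFactor G) (d : ChiefFactor H) : Prop :=
  ∃ e : c.Carrier ≃* d.Carrier, ∀ φ : MulAut c.Carrier,
    φ ∈ c.action.range ↔ MulAut.congr e φ ∈ d.action.range

theorem Similar.symm {c : ChiefFactor G} {d : ChiefFactor H} (h : c.Similar d) : d.Similar c := by
  obtain ⟨e, he⟩ := h
  refine ⟨e.symm, fun φ => ?_⟩
  rw [he]
  have : MulAut.congr e (MulAut.congr e.symm φ) = φ := by ext; simp [MulAut.congr]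
  rw [this]

theorem Similar.trans {K : Type u} [Group K] {c : ChiefFactor G} {d : ChiefFactor H}
    {k : ChiefFactor K} (h : c.Similar d) (h' : d.Similar k) : c.Similar k := by
  obtain ⟨e, he⟩ := h
  obtain ⟨e', he'⟩ := h'
  refine ⟨e.trans e', fun φ => ?_⟩
  rw [he, he']
  rfl

/-- The group homomorphism `π` identifies the section `c` of `G` with the section `d` of `H`. -/
theorem similar_of_map {c : ChiefFactor G} {d : ChiefFactor H} (π : G →* H)
    (hπ : Function.Surjective π) (h₁ : ∀ x ∈ c.top, π x ∈ d.top)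
    (h₂ : ∀ x ∈ c.top, x ∈ c.bot ↔ π x ∈ d.bot)
    (h₃ : ∀ y ∈ d.top, ∃ x ∈ c.top, (π x)⁻¹ * y ∈ d.bot) : c.Similar d := by
  let f : c.top →* d.top := (π.comp c.top.subtype).codRestrict d.top fun x => h₁ x x.2
  have hle : c.bot.subgroupOf c.top ≤ (d.bot.subgroupOf d.top).comap f := fun x hx =>
    (h₂ x x.2).1 hx
  let F : c.Carrier →* d.Carrier := QuotientGroup.map _ _ f hle
  have hF : Function.Bijective F := by
    constructor
    · rw [injective_iff_map_eq_one]
      rintro ⟨x⟩ hx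
      exact (c.mk_eq_one_iff x).2 ((h₂ x x.2).2 ((d.mk_eq_one_iff (f x)).1 hx))
    · rintro ⟨y⟩
      obtain ⟨x, hx, hxy⟩ := h₃ y y.2
      refine ⟨((⟨x, hx⟩ : c.top) : c.Carrier), ?_⟩
      change ((f ⟨x, hx⟩ : d.top) : d.Carrier) = (y : d.Carrier)
      rw [QuotientGroup.eq]
      exact hxy
  let e := MulEquiv.ofBijective F hF
  have key (g : G) : MulAut.congr e (c.action g) = d.action (π g) := by
    ext y
    obtain ⟨x, rfl⟩ := e.surjective y
    change e (c.action g (e.symm (e x))) = _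
    rw [e.symm_apply_apply]
    induction x using QuotientGroup.induction_on with | _ x =>
    change ((f (MulAut.conjNormal g x) : d.top) : d.Carrier) =
      ((MulAut.conjNormal (π g) (f x) : d.top) : d.Carrier)
    congr 1
    ext
    change π (g * x * g⁻¹) = π g * π x * (π g)⁻¹
    simp
  refine ⟨e, fun φ => ⟨?_, ?_⟩⟩
  · rintro ⟨g, rfl⟩
    exact ⟨π g, (key g).symm⟩
  · rintro ⟨y, hy⟩
    obtain ⟨g, rfl⟩ := hπ y
    exact ⟨g, (MulAut.congr e).injective ((key g).trans hy)⟩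

/-- The preimage of a chief factor under a surjective homomorphism. -/
def comap (d : ChiefFactor H) (π : G →* H) (hπ : Function.Surjective π) : ChiefFactor G where
  top := d.top.comap π
  bot := d.bot.comap π
  top_normal := inferInstance
  bot_normal := inferInstance
  lt := (Subgroup.comap_lt_comap_of_surjective hπ).2 d.lt
  eq_or_eq L hL h₁ h₂ := by
    have hker : π.ker ≤ L := (Subgroup.ker_le_comap π d.bot).trans h₁
    have hL' : (L.map π).comap π = L := Subgroup.comap_map_eq_self hker
    rcases d.eq_or_eq (L.map π) (hL.map π hπ)
      ((Subgroup.comap_le_comap_of_surjective hπ).1 (hL'.symm ▸ h₁))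
      (Subgroup.map_le_iff_le_comap.2 h₂) with h | h
    · left; rw [← h, hL']
    · right; rw [← h, hL']

theorem comap_similar (d : ChiefFactor H) (π : G →* H) (hπ : Function.Surjective π) :
    (d.comap π hπ).Similar d :=
  similar_of_map π hπ (fun _ hx => hx) (fun _ _ => Iff.rfl) fun y hy => by
    obtain ⟨x, rfl⟩ := hπ y
    exact ⟨x, hy, by simp⟩

/-- The image of a chief factor under a surjective homomorphism whose kernel lies below it. -/
def map (c : ChiefFactor G) (π : G →* H) (hπ : Function.Surjective π) (hker : π.ker ≤ c.bot) :
    ChiefFactor H where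
  top := c.top.map π
  bot := c.bot.map π
  top_normal := c.top_normal.map π hπ
  bot_normal := c.bot_normal.map π hπ
  lt := by
    rw [← Subgroup.comap_lt_comap_of_surjective hπ, Subgroup.comap_map_eq_self hker,
      Subgroup.comap_map_eq_self (hker.trans c.lt.le)]
    exact c.lt
  eq_or_eq L hL h₁ h₂ := by
    have hL' : (L.comap π).map π = L := Subgroup.map_comap_eq_self_of_surjective hπ L
    rcases c.eq_or_eq (L.comap π) (hL.comap π) (Subgroup.map_le_iff_le_comap.1 h₁)
      ((Subgroup.comap_mono h₂).trans
        (Subgroup.comap_map_eq_self (hker.trans c.lt.le)).le) with h | h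
    · left; rw [← h, hL']
    · right; rw [← h, hL']

theorem similar_map (c : ChiefFactor G) (π : G →* H) (hπ : Function.Surjective π)
    (hker : π.ker ≤ c.bot) : c.Similar (c.map π hπ hker) :=
  similar_of_map π hπ (fun _ hx => Subgroup.mem_map_of_mem π hx)
    (fun x _ => ⟨fun hx => Subgroup.mem_map_of_mem π hx, fun hx => by
      rw [← Subgroup.comap_map_eq_self hker]; exact hx⟩)
    (by rintro _ ⟨x, hx, rfl⟩; exact ⟨x, hx, by simp⟩)

/-- A normal subgroup that does not avoid a chief factor covers it. -/
theorem eq_sup_inf (c : ChiefFactor G) (T : Subgroup G) [T.Normal] (h : ¬ c.top ⊓ T ≤ c.bot) :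
    c.bot ⊔ c.top ⊓ T = c.top :=
  (c.eq_or_eq (c.bot ⊔ c.top ⊓ T) inferInstance le_sup_left
    (sup_le c.lt.le inf_le_left)).resolve_left fun h' => h (le_sup_right.trans h'.le)

/-- The chief factor that `c` cuts out in a normal subgroup `T` covering `c`. -/
def inf (c : ChiefFactor G) (T : Subgroup G) [T.Normal] (h : ¬ c.top ⊓ T ≤ c.bot) :
    ChiefFactor G where
  top := c.top ⊓ T
  bot := c.bot ⊓ T
  top_normal := inferInstance
  bot_normal := inferInstance
  lt := lt_of_le_not_ge (inf_le_inf_right T c.lt.le) fun h' => h (h'.trans inf_le_left)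
  eq_or_eq L hL h₁ h₂ := by
    rcases c.eq_or_eq (c.bot ⊔ L) inferInstance le_sup_left
      (sup_le c.lt.le (h₂.trans inf_le_left)) with h' | h'
    · left
      exact le_antisymm (le_inf (le_sup_right.trans h'.le) (h₂.trans inf_le_right)) h₁
    · right
      refine le_antisymm h₂ fun x hx => ?_
      obtain ⟨b, hb, l, hl, rfl⟩ := Subgroup.mem_sup_of_normal_left.1 (h'.symm ▸ hx.1)
      refine mul_mem (h₁ ⟨hb, ?_⟩) hl
      exact (T.mul_mem_cancel_right (h₂ hl).2).1 hx.2

theorem inf_similar (c : ChiefFactor G) (T : Subgroup G) [T.Normal] (h : ¬ c.top ⊓ T ≤ c.bot) :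
    (c.inf T h).Similar c :=
  similar_of_map (MonoidHom.id G) Function.surjective_id (fun _ hx => hx.1)
    (fun _ hx => ⟨fun hb => hb.1, fun hb => ⟨hb, hx.2⟩⟩) fun y hy => by
      obtain ⟨x, hx, b, hb, rfl⟩ :=
        Subgroup.mem_sup_of_normal_right.1 ((sup_comm _ _).trans (c.eq_sup_inf T h) ▸ hy)
      exact ⟨x, hx, by simpa using hb⟩

/-- The chief factor that `c` becomes above a normal subgroup `T` avoiding `c`. -/
def sup (c : ChiefFactor G) (T : Subgroup G) [T.Normal] (h : c.top ⊓ T ≤ c.bot) :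
    ChiefFactor G where
  top := c.top ⊔ T
  bot := c.bot ⊔ T
  top_normal := inferInstance
  bot_normal := inferInstance
  lt := lt_of_le_not_ge (sup_le_sup_right c.lt.le T) fun h' => c.lt.not_ge fun x hx => by
    obtain ⟨b, hb, t, ht, rfl⟩ :=
      Subgroup.mem_sup_of_normal_right.1 (h' (Subgroup.mem_sup_left hx))
    exact mul_mem hb (h ⟨(mul_mem_cancel_left (c.lt.le hb)).1 hx, ht⟩)
  eq_or_eq L hL h₁ h₂ := by
    have hL' : L ≤ (c.top ⊓ L) ⊔ T := fun x hx => by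
      obtain ⟨b, hb, t, ht, rfl⟩ := Subgroup.mem_sup_of_normal_right.1 (h₂ hx)
      exact mul_mem (Subgroup.mem_sup_left ⟨hb, (mul_mem_cancel_right
        (h₁ (Subgroup.mem_sup_right ht))).1 hx⟩) (Subgroup.mem_sup_right ht)
    rcases c.eq_or_eq (c.top ⊓ L) inferInstance (le_inf c.lt.le (le_sup_left.trans h₁))
      inf_le_left with h' | h'
    · left
      exact le_antisymm (h' ▸ hL') h₁
    · right
      exact le_antisymm h₂ (sup_le (inf_eq_left.1 h') (le_sup_right.trans h₁))

theorem similar_sup (c : ChiefFactor G) (T : Subgroup G) [T.Normal] (h : c.top ⊓ T ≤ c.bot) :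
    c.Similar (c.sup T h) :=
  similar_of_map (MonoidHom.id G) Function.surjective_id (fun _ hx => Subgroup.mem_sup_left hx)
    (fun x hx => ⟨fun hb => Subgroup.mem_sup_left hb, fun hb => by
      obtain ⟨b, hb', t, ht, rfl⟩ := Subgroup.mem_sup_of_normal_right.1 hb
      exact mul_mem hb' (h ⟨(mul_mem_cancel_left (c.lt.le hb')).1 hx, ht⟩)⟩) fun y hy => by
      obtain ⟨x, hx, t, ht, rfl⟩ := Subgroup.mem_sup_of_normal_right.1 hy
      refine ⟨x, hx, ?_⟩
      change x⁻¹ * (x * t) ∈ c.bot ⊔ T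
      rw [inv_mul_cancel_left]
      exact Subgroup.mem_sup_right ht

/-- In a finite group there is a chief factor just below any proper inclusion of normal
subgroups. -/
theorem exists_top_eq [Finite G] (K L : Subgroup G) [hK : K.Normal] [hL : L.Normal] (h : K < L) :
    ∃ c : ChiefFactor G, c.top = L ∧ K ≤ c.bot := by
  obtain ⟨M, ⟨hM, hKM, hML⟩, hmax⟩ := exists_maximal_of_wellFoundedGT
    (fun M : Subgroup G => M.Normal ∧ K ≤ M ∧ M < L) ⟨K, hK, le_rfl, h⟩
  refine ⟨⟨L, M, hL, hM, hML, fun T hT h₁ h₂ => ?_⟩, rfl, hKM⟩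
  rcases h₂.eq_or_lt with h₂ | h₂
  · exact Or.inr h₂
  · exact Or.inl (le_antisymm (hmax ⟨hT, hKM.trans h₁, h₂⟩ h₁) h₁)

/-- In a finite group there is a chief factor just above any proper inclusion of normal
subgroups. -/
theorem exists_bot_eq [Finite G] (K L : Subgroup G) [hK : K.Normal] [hL : L.Normal] (h : K < L) :
    ∃ c : ChiefFactor G, c.bot = K ∧ c.top ≤ L := by
  obtain ⟨M, ⟨hM, hKM, hML⟩, hmin⟩ := exists_minimal_of_wellFoundedLT
    (fun M : Subgroup G => M.Normal ∧ K < M ∧ M ≤ L) ⟨L, hL, h, le_rfl⟩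
  refine ⟨⟨M, K, hM, hK, hKM, fun T hT h₁ h₂ => ?_⟩, rfl, hML⟩
  rcases h₁.eq_or_lt with h₁ | h₁
  · exact Or.inl h₁.symm
  · exact Or.inr (le_antisymm h₂ (hmin ⟨hT, h₁, h₂.trans hML⟩ h₂))

end ChiefFactor

/-! ### Central chief factors -/

namespace ChiefFactor

variable {G H : Type u} [Group G] [Group H] {X : GroupClass.{u}}

theorem Similar.semidirectProd {c : ChiefFactor G} {d : ChiefFactor H} (h : c.Similar d) :
    Nonempty (c.SemidirectProd ≃* d.SemidirectProd) := by
  obtain ⟨e, he⟩ := h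
  have hrange : c.action.range.map (MulAut.congr e).toMonoidHom = d.action.range := by
    ext φ
    constructor
    · rintro ⟨ψ, hψ, rfl⟩
      exact (he ψ).1 hψ
    · intro hφ
      refine ⟨(MulAut.congr e).symm φ, (he _).2 ?_, (MulAut.congr e).apply_symm_apply φ⟩
      rwa [(MulAut.congr e).apply_symm_apply φ]
  let r : c.action.range ≃* d.action.range :=
    ((MulAut.congr e).subgroupMap c.action.range).trans (MulEquiv.subgroupCongr hrange)
  let q : (G ⧸ c.centralizer) ≃* (H ⧸ d.centralizer) :=
    ((QuotientGroup.quotientKerEquivRange c.action).trans r).trans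
      (QuotientGroup.quotientKerEquivRange d.action).symm
  have hq (g : G ⧸ c.centralizer) :
      QuotientGroup.kerLift d.action (q g) =
        MulAut.congr e (QuotientGroup.kerLift c.action g) := by
    have hc : ((QuotientGroup.quotientKerEquivRange c.action g : c.action.range) :
        MulAut c.Carrier) = QuotientGroup.kerLift c.action g := by
      obtain ⟨g⟩ := g
      rfl
    have hd (y : H ⧸ d.centralizer) :
        ((QuotientGroup.quotientKerEquivRange d.action y : d.action.range) :
          MulAut d.Carrier) = QuotientGroup.kerLift d.action y := by
      obtain ⟨y⟩ := y
      rfl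
    rw [← hc, ← hd, MulEquiv.trans_apply, MulEquiv.apply_symm_apply]
    rfl
  refine ⟨SemidirectProduct.congr e q fun g => ?_⟩
  ext x
  simp [hq, MulAut.congr]

theorem Similar.isCentral_iff {c : ChiefFactor G} {d : ChiefFactor H} (h : c.Similar d)
    (hX : IsFormation X) : c.IsCentral X ↔ d.IsCentral X := by
  obtain ⟨e⟩ := h.semidirectProd
  exact ⟨hX.mulEquiv e, hX.mulEquiv e.symm⟩

end ChiefFactor

/-- The group of pairs of elements of `G` that are congruent modulo the normal subgroup `L`. It is
isomorphic to the semidirect product of `L` by `G`. -/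
def congruentPairs {G : Type u} [Group G] (L : Subgroup G) [L.Normal] : Subgroup (G × G) where
  carrier := {z | z.1 * z.2⁻¹ ∈ L}
  one_mem' := by simp
  mul_mem' {x y} hx hy := by
    have : (x * y).1 * (x * y).2⁻¹ = x.1 * (y.1 * y.2⁻¹) * x.1⁻¹ * (x.1 * x.2⁻¹) := by
      simp only [Prod.fst_mul, Prod.snd_mul]; group
    change _ ∈ L
    rw [this]
    exact mul_mem (Subgroup.Normal.conj_mem inferInstance _ hy _) hx
  inv_mem' {x} hx := by
    have : (x⁻¹).1 * (x⁻¹).2⁻¹ = x.1⁻¹ * (x.1 * x.2⁻¹)⁻¹ * x.1⁻¹⁻¹ := by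
      simp only [Prod.fst_inv, Prod.snd_inv]; group
    change _ ∈ L
    rw [this]
    exact Subgroup.Normal.conj_mem inferInstance _ (inv_mem hx) _

theorem mem_congruentPairs {G : Type u} [Group G] {L : Subgroup G} [L.Normal] {z : G × G} :
    z ∈ congruentPairs L ↔ z.1 * z.2⁻¹ ∈ L := Iff.rfl

namespace ChiefFactor

variable {G H : Type u} [Group G] [Group H] {X : GroupClass.{u}}

/-- The semidirect product attached to a chief factor, as a quotient of the group of congruent
pairs: `(x, y)` goes to `(x * y⁻¹, y)`. -/
def pairHom (c : ChiefFactor G) : congruentPairs c.top →* c.SemidirectProd where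
  toFun z := ⟨((⟨z.1.1 * z.1.2⁻¹, z.2⟩ : c.top) : c.Carrier), (z.1.2 : G ⧸ c.centralizer)⟩
  map_one' := by
    ext
    · change ((_ : c.top) : c.Carrier) = 1
      rw [mk_eq_one_iff]
      simp
    · rfl
  map_mul' x y := by
    ext
    · change ((_ : c.top) : c.Carrier) =
        ((⟨x.1.1 * x.1.2⁻¹, x.2⟩ * MulAut.conjNormal x.1.2 ⟨y.1.1 * y.1.2⁻¹, y.2⟩ : c.top) :
          c.Carrier)
      congr 1
      ext
      simp
      group
    · rfl

theorem pairHom_eq_one_iff (c : ChiefFactor G) (z : congruentPairs c.top) :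
    c.pairHom z = 1 ↔ z.1.1 * z.1.2⁻¹ ∈ c.bot ∧ z.1.2 ∈ c.centralizer := by
  rw [SemidirectProduct.ext_iff]
  exact and_congr (c.mk_eq_one_iff _) (QuotientGroup.eq_one_iff _)

theorem pairHom_surjective (c : ChiefFactor G) : Function.Surjective c.pairHom := by
  rintro ⟨⟨a⟩, ⟨g⟩⟩
  refine ⟨⟨(a * g, g), by simp [mem_congruentPairs]⟩, ?_⟩
  ext
  · change ((_ : c.top) : c.Carrier) = ((a : c.top) : c.Carrier)
    congr 1
    ext
    simp
  · rfl

/-- All chief factors of the members of a formation are central: the semidirect product of a normal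
subgroup by the group is a subdirect product of two copies of the group. -/
theorem isCentral_of_mem (hX : IsFormation X) (hG : X G) (c : ChiefFactor G) : c.IsCentral X := by
  have := hX.finite G hG
  have hq : X (G ⧸ c.bot) := hX.image _ _ (QuotientGroup.mk' c.bot)
    (QuotientGroup.mk'_surjective c.bot) hG
  have htop : X (⊤ : Subgroup (G ⧸ c.bot)) := hX.mulEquiv Subgroup.topEquiv.symm hq
  let f₁ : congruentPairs c.top →* G ⧸ c.bot :=
    ((QuotientGroup.mk' c.bot).comp (MonoidHom.fst G G)).comp (congruentPairs c.top).subtype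
  let f₂ : congruentPairs c.top →* G ⧸ c.bot :=
    ((QuotientGroup.mk' c.bot).comp (MonoidHom.snd G G)).comp (congruentPairs c.top).subtype
  have hdiag (g : G) : (g, g) ∈ congruentPairs c.top := by simp [mem_congruentPairs]
  have h₁ : f₁.range = ⊤ := by
    rw [MonoidHom.range_eq_top]
    rintro ⟨g⟩
    exact ⟨⟨_, hdiag g⟩, rfl⟩
  have h₂ : f₂.range = ⊤ := by
    rw [MonoidHom.range_eq_top]
    rintro ⟨g⟩
    exact ⟨⟨_, hdiag g⟩, rfl⟩
  refine hX.subdirect (f₁ := f₁) (f₂ := f₂) (h₁ ▸ htop) (h₂ ▸ htop) c.pairHom_surjective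
    fun z hz₁ hz₂ => ?_
  have hz₁' : z.1.1 ∈ c.bot := (QuotientGroup.eq_one_iff _).1 hz₁
  have hz₂' : z.1.2 ∈ c.bot := (QuotientGroup.eq_one_iff _).1 hz₂
  exact (c.pairHom_eq_one_iff z).2
    ⟨mul_mem hz₁' (inv_mem hz₂'), c.bot_le_centralizer hz₂'⟩

/-! ### Inner automorphisms on composition factors -/

/-- A composition factor of the image of `ψ` yields one of the target of `α`, if the kernel of `ψ`
contains that of `α`. -/
theorem isCompositionFactor_map_comap {L V W : Type u} [Group L] [Group V] [Group W]
    {α : L →* V} {ψ : L →* W} (hα : α.range.IsSubnormal) (hψ : Function.Surjective ψ)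
    (hker : α.ker ≤ ψ.ker) {A B : Subgroup W} (h : IsCompositionFactor A B) :
    IsCompositionFactor ((A.comap ψ).map α) ((B.comap ψ).map α) := by
  have hle : B.comap ψ ≤ A.comap ψ := Subgroup.comap_mono h.le
  have hmem (l : L) (hl : α l ∈ (B.comap ψ).map α) : ψ l ∈ B := by
    obtain ⟨b, hb, hbl⟩ := hl
    have : b⁻¹ * l ∈ ψ.ker := hker (by rw [MonoidHom.mem_ker, map_mul, map_inv, hbl]; simp)
    rw [MonoidHom.mem_ker, map_mul, map_inv, inv_mul_eq_one] at this
    rw [← this]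
    exact hb
  have hn := h.normal
  have hn' : (((B.comap ψ).map α).subgroupOf ((A.comap ψ).map α)).Normal := by
    refine ⟨?_⟩
    rintro ⟨_, b, hb, rfl⟩ hb' ⟨_, a, ha, rfl⟩
    refine ⟨a * b * a⁻¹, ?_, by simp⟩
    have := hn.conj_mem ⟨ψ b, hb⟩ (hmem b hb') ⟨ψ a, ha⟩
    simpa [Subgroup.mem_subgroupOf] using this
  refine ⟨?_, Subgroup.map_mono hle, hn', ?_⟩
  · have h₁ : (A.comap ψ).map α.rangeRestrict =
        ((A.comap ψ).map α).subgroupOf α.range := by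
      ext ⟨_, l, rfl⟩
      constructor
      · rintro ⟨a, ha, hal⟩
        exact ⟨a, ha, congrArg Subtype.val hal⟩
      · rintro ⟨a, ha, hal⟩
        exact ⟨a, ha, Subtype.ext hal⟩
    refine Subgroup.IsSubnormal.trans (K := α.range) ?_ ?_ hα
    · rintro _ ⟨a, -, rfl⟩
      exact ⟨a, rfl⟩
    · rw [← h₁]
      exact (h.subnormal.comap ψ).map α.rangeRestrict_surjective
  · let p : A.comap ψ →* A ⧸ B.subgroupOf A :=
      (QuotientGroup.mk' _).comp (ψ.subgroupComap A)
    let q : A.comap ψ →* ((A.comap ψ).map α) ⧸ ((B.comap ψ).map α).subgroupOf _ :=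
      (QuotientGroup.mk' _).comp (α.subgroupMap (A.comap ψ))
    have hp : Function.Surjective p := (QuotientGroup.mk'_surjective _).comp
      (by rintro ⟨a, ha⟩; obtain ⟨l, rfl⟩ := hψ a; exact ⟨⟨l, ha⟩, rfl⟩)
    have hq : Function.Surjective q := (QuotientGroup.mk'_surjective _).comp
      (α.subgroupMap_surjective _)
    have hpq : p.ker = q.ker := by
      ext l
      rw [MonoidHom.mem_ker, MonoidHom.mem_ker]
      refine (QuotientGroup.eq_one_iff _).trans (Iff.trans ?_ (QuotientGroup.eq_one_iff _).symm)
      exact ⟨fun hl => ⟨l, hl, rfl⟩, fun hl => hmem l hl⟩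
    have e : (((A.comap ψ).map α) ⧸ ((B.comap ψ).map α).subgroupOf _) ≃*
        (A ⧸ B.subgroupOf A) :=
      ((QuotientGroup.quotientKerEquivOfSurjective q hq).symm.trans
        (QuotientGroup.quotientMulEquivOfEq hpq.symm)).trans
        (QuotientGroup.quotientKerEquivOfSurjective p hp)
    have := h.simple
    exact MulEquiv.isSimpleGroup e

/-- Transfer of the condition on inner automorphisms from a chief factor to a subnormal section of
it. The section is given by a group `L` that maps onto it by `ψ` and onto a subnormal subgroup of
the chief factor by `α`; `τ` lifts an automorphism induced on the section to `L`. -/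
theorem InducesInner.of_section {c : ChiefFactor G} {d : ChiefFactor H} (h : c.InducesInner)
    {L : Type u} [Group L] {α : L →* c.Carrier} {ψ : L →* d.Carrier}
    (hα : α.range.IsSubnormal) (hψ : Function.Surjective ψ) (hker : α.ker ≤ ψ.ker)
    (hτ : ∀ y : H, ∃ x : G, ∃ τ : MulAut L,
      (∀ l, α (τ l) = c.action x (α l)) ∧ ∀ l, ψ (τ l) = d.action y (ψ l)) :
    d.InducesInner := by
  intro y A B hAB hA hB
  obtain ⟨x, τ, hτ₁, hτ₂⟩ := hτ y
  have hinv (U : Subgroup d.Carrier) (hU : U.map (d.action y).toMonoidHom = U) :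
      ((U.comap ψ).map α).map (c.action x).toMonoidHom = (U.comap ψ).map α := by
    apply le_antisymm
    · rintro _ ⟨_, ⟨l, hl, rfl⟩, rfl⟩
      refine ⟨τ l, ?_, hτ₁ l⟩
      change ψ (τ l) ∈ U
      rw [hτ₂, ← hU]
      exact ⟨ψ l, hl, rfl⟩
    · rintro _ ⟨l, hl, rfl⟩
      obtain ⟨m, rfl⟩ := τ.surjective l
      refine ⟨α m, ⟨m, ?_, rfl⟩, (hτ₁ m).symm⟩
      have hl' : ψ (τ m) ∈ U := hl
      rw [hτ₂, ← hU] at hl'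
      obtain ⟨w, hw, hwm⟩ := hl'
      have : w = ψ m := (d.action y).injective hwm
      change ψ m ∈ U
      exact this ▸ hw
  obtain ⟨_, ⟨l, hl, rfl⟩, ha⟩ := h x _ _ (isCompositionFactor_map_comap hα hψ hker hAB)
    (hinv A hA) (hinv B hB)
  refine ⟨ψ l, hl, fun z hz => ?_⟩
  obtain ⟨m, rfl⟩ := hψ z
  obtain ⟨b, hb, hbm⟩ := ha (α m) ⟨m, hz, rfl⟩
  have : b⁻¹ * ((l * m * l⁻¹)⁻¹ * τ m) ∈ ψ.ker := hker (by
    rw [MonoidHom.mem_ker, map_mul, map_inv, hbm, ← hτ₁]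
    simp only [map_mul, map_inv]
    group)
  rw [MonoidHom.mem_ker, map_mul, map_inv, inv_mul_eq_one] at this
  have hb' : ψ b ∈ B := hb
  rw [this] at hb'
  simpa [hτ₂] using hb'

theorem Similar.inducesInner {c : ChiefFactor G} {d : ChiefFactor H} (h : c.Similar d)
    (hc : c.InducesInner) : d.InducesInner := by
  obtain ⟨e, he⟩ := h
  refine hc.of_section (α := MonoidHom.id _) (ψ := e.toMonoidHom) ?_ e.surjective ?_ fun y => ?_
  · rw [MonoidHom.range_eq_top.2 Function.surjective_id]
    exact Subgroup.Normal.isSubnormal inferInstance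
  · intro l hl
    have : l = 1 := hl
    simp [this]
  · have hy : (MulAut.congr e).symm (d.action y) ∈ c.action.range := by
      rw [he, (MulAut.congr e).apply_symm_apply]
      exact ⟨y, rfl⟩
    obtain ⟨x, hx⟩ := hy
    refine ⟨x, c.action x, fun _ => rfl, fun l => ?_⟩
    rw [hx]
    change e (e.symm (d.action y (e l))) = _
    simp

/-! ### Generalized ranks -/

theorem Similar.nonempty_mulEquiv {c : ChiefFactor G} {d : ChiefFactor H} (h : c.Similar d) :
    Nonempty (c.Carrier ≃* d.Carrier) := let ⟨e, _⟩ := h; ⟨e⟩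

end ChiefFactor

theorem IsSimplePower.mulEquiv {S N M : Type u} [Group S] [Group N] [Group M] {n : ℕ}
    (h : IsSimplePower S n N) (e : N ≃* M) : IsSimplePower S n M :=
  ⟨h.1, h.2.map fun f => e.symm.trans f⟩

theorem IsSimplePower.ne_zero {S N : Type u} [Group S] [Group N] [Nontrivial N] {n : ℕ}
    (h : IsSimplePower S n N) : n ≠ 0 := by
  rintro rfl
  obtain ⟨e⟩ := h.2
  exact not_subsingleton N e.injective.subsingleton

theorem IsSimplePower.finite {S N : Type u} [Group S] [Group N] [Finite N] {n : ℕ}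
    (h : IsSimplePower S n N) (hn : n ≠ 0) : Finite S := by
  obtain ⟨e⟩ := h.2
  have : Nonempty (Fin n) := ⟨⟨0, Nat.pos_of_ne_zero hn⟩⟩
  have : Finite (Fin n → S) := Finite.of_equiv N e
  exact Finite.of_surjective (fun f : Fin n → S => f (Classical.arbitrary _))
    (Function.surjective_eval _)

namespace ChiefFactor

variable {G H : Type u} [Group G] [Group H] {X : GroupClass.{u}}

theorem Similar.generalizedRankIn {c : ChiefFactor G} {d : ChiefFactor H} [Finite G]
    (h : c.Similar d) {R : GeneralizedRankFunction.{u}} (hc : c.GeneralizedRankIn R) :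
    d.GeneralizedRankIn R := by
  obtain ⟨e⟩ := h.nonempty_mulEquiv
  have key (n : ℕ) (hn : c.HasRank n) :
      d.HasRank n ∧ R.A c.Carrier = R.A d.Carrier ∧ R.B c.Carrier = R.B d.Carrier := by
    obtain ⟨S, _, hS⟩ := hn
    have := hS.finite hS.ne_zero
    have hc := R.eq_of_power S c.Carrier n hS.ne_zero hS
    have hd := R.eq_of_power S d.Carrier n hS.ne_zero (hS.mulEquiv e)
    exact ⟨⟨S, _, hS.mulEquiv e⟩, hc.1.trans hd.1.symm, hc.2.trans hd.2.symm⟩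
  rcases hc with ⟨n, hnA, hn⟩ | ⟨⟨n, hnB, hn⟩, hi⟩
  · obtain ⟨h₁, h₂, -⟩ := key n hn
    exact Or.inl ⟨n, h₂ ▸ hnA, h₁⟩
  · obtain ⟨h₁, -, h₂⟩ := key n hn
    exact Or.inr ⟨⟨n, h₂ ▸ hnB, h₁⟩, h.inducesInner hi⟩

/-- The condition that membership in `X(R)` imposes on a chief factor. -/
def IsAdmissible (X : GroupClass.{u}) (R : GeneralizedRankFunction.{u}) (c : ChiefFactor G) :
    Prop :=
  ¬ c.IsCentral X → ¬ X c.Carrier ∧ c.GeneralizedRankIn R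

theorem Similar.isAdmissible {c : ChiefFactor G} {d : ChiefFactor H} [Finite G]
    (h : c.Similar d) (hX : IsFormation X) {R : GeneralizedRankFunction.{u}}
    (hc : c.IsAdmissible X R) : d.IsAdmissible X R := by
  intro hd
  obtain ⟨e⟩ := h.nonempty_mulEquiv
  obtain ⟨h₁, h₂⟩ := hc fun hc' => hd ((h.isCentral_iff hX).1 hc')
  exact ⟨fun hXd => h₁ (hX.mulEquiv e.symm hXd), h.generalizedRankIn h₂⟩

end ChiefFactor

/-! ### The class `X(R)` is a formation -/

section WithRank

variable {X : GroupClass.{u}} {R : GeneralizedRankFunction.{u}}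

theorem IsFormation.subclass_withRank (hX : IsFormation X) : X.Subclass (X.withRank R) :=
  fun G _ hG => ⟨hX.finite G hG, fun c hc => (hc (c.isCentral_of_mem hX hG)).elim⟩

/-- The chief factors above the kernel of a surjection onto a group in `X(R)` are admissible. -/
theorem isAdmissible_of_ker_le (hX : IsFormation X) {G Q : Type u} [Group G] [Group Q]
    (hQ : X.withRank R Q) (π : G →* Q) (hπ : Function.Surjective π) (c : ChiefFactor G)
    (hc : π.ker ≤ c.bot) : c.IsAdmissible X R :=
  have := hQ.1
  (c.similar_map π hπ hc).symm.isAdmissible hX (hQ.2 _)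

theorem isFormation_withRank (hX : IsFormation X) : IsFormation (X.withRank R) where
  finite G _ hG := hG.1
  image G H _ _ f hf hG := by
    have := hG.1
    exact ⟨Finite.of_surjective f hf, fun c =>
      (c.comap_similar f hf).isAdmissible hX (hG.2 _)⟩
  inf G _ _ M N _ _ hM hN := by
    refine ⟨inferInstance, fun c₀ => ?_⟩
    have hmk := QuotientGroup.mk'_surjective (M ⊓ N)
    refine (c₀.comap_similar _ hmk).isAdmissible hX ?_
    generalize hc : c₀.comap (QuotientGroup.mk' (M ⊓ N)) hmk = c
    have hle : M ⊓ N ≤ c.bot := by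
      rw [← hc]
      exact (QuotientGroup.ker_mk' (M ⊓ N)).ge.trans (Subgroup.ker_le_comap _ _)
    by_cases h : c.top ⊓ M ≤ c.bot
    · refine (c.similar_sup M h).symm.isAdmissible hX (isAdmissible_of_ker_le hX hM
        (QuotientGroup.mk' M) (QuotientGroup.mk'_surjective M) _ ?_)
      rw [QuotientGroup.ker_mk']
      exact le_sup_right
    · -- `c` is similar to a chief factor inside `M`, which `N` avoids.
      refine (c.inf_similar M h).isAdmissible hX ?_
      have h' : (c.inf M h).top ⊓ N ≤ (c.inf M h).bot :=
        fun x hx => ⟨hle ⟨hx.1.2, hx.2⟩, hx.1.2⟩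
      refine ((c.inf M h).similar_sup N h').symm.isAdmissible hX (isAdmissible_of_ker_le hX hN
        (QuotientGroup.mk' N) (QuotientGroup.mk'_surjective N) _ ?_)
      rw [QuotientGroup.ker_mk']
      exact le_sup_right

end WithRank

/-! ### Abelian chief factors and the soluble radical -/

namespace ChiefFactor

variable {G : Type u} [Group G]

/-- A chief factor has no proper non-trivial subgroups that are invariant under the action. -/
theorem eq_bot_or_eq_top_of_invariant (c : ChiefFactor G) (W : Subgroup c.Carrier)
    (h : ∀ g, ∀ w ∈ W, c.action g w ∈ W) : W = ⊥ ∨ W = ⊤ := by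
  let L : Subgroup G := (W.comap (QuotientGroup.mk' _)).map c.top.subtype
  have hmem (a : c.top) : (a : G) ∈ L ↔ (a : c.Carrier) ∈ W := by
    constructor
    · rintro ⟨b, hb, hba⟩
      exact Subtype.ext hba ▸ hb
    · exact fun ha => ⟨a, ha, rfl⟩
  have hL : L.Normal := by
    refine ⟨?_⟩
    rintro _ ⟨a, ha, rfl⟩ g
    exact ⟨MulAut.conjNormal g a, h g _ ha, by simp⟩
  have hbot : c.bot ≤ L := fun b hb => by
    refine (hmem ⟨b, c.lt.le hb⟩).2 ?_
    rw [(c.mk_eq_one_iff _).2 hb]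
    exact one_mem W
  have htop : L ≤ c.top := by
    rintro _ ⟨a, -, rfl⟩
    exact a.2
  rcases c.eq_or_eq L hL hbot htop with h' | h'
  · left
    rw [eq_bot_iff]
    rintro ⟨a⟩ ha
    exact (c.mk_eq_one_iff a).2 (h' ▸ (hmem a).2 ha)
  · right
    rw [eq_top_iff]
    rintro ⟨a⟩ -
    exact (hmem a).1 (h'.symm ▸ a.2)

theorem exists_isAbelianPFactor [Finite G] (c : ChiefFactor G) (h : IsMulCommutative c.Carrier) :
    ∃ p : Nat.Primes, c.IsAbelianPFactor p := by
  obtain ⟨p, hp, hdvd⟩ := Nat.exists_prime_and_dvd (Finite.one_lt_card (α := c.Carrier)).ne'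
  have := Fact.mk hp
  obtain ⟨a, ha⟩ := exists_prime_orderOf_dvd_card' p hdvd
  refine ⟨⟨p, hp⟩, h, ?_⟩
  let W : Subgroup c.Carrier :=
    { carrier := {x | x ^ p = 1}
      one_mem' := one_pow p
      mul_mem' := fun {x y} hx hy => by
        have : (x * y) ^ p = x ^ p * y ^ p := Commute.mul_pow (h.is_comm.comm x y) p
        change (x * y) ^ p = 1
        rw [this, show x ^ p = 1 from hx, show y ^ p = 1 from hy, one_mul]
      inv_mem' := fun {x} hx => by
        change x⁻¹ ^ p = 1
        rw [inv_pow, show x ^ p = 1 from hx, inv_one] }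
  have hW := c.eq_bot_or_eq_top_of_invariant W fun g w hw => by
    change c.action g w ^ p = 1
    rw [← map_pow, show w ^ p = 1 from hw, map_one]
  have hWtop : W = ⊤ := hW.resolve_left fun h' => by
    have ha' : a ∈ W := show a ^ p = 1 from ha ▸ pow_orderOf_eq_one a
    rw [h', Subgroup.mem_bot] at ha'
    rw [ha', orderOf_one] at ha
    exact hp.one_lt.ne ha
  intro x
  refine ⟨1, ?_⟩
  have hx : x ∈ W := hWtop ▸ Subgroup.mem_top x
  rw [pow_one]
  exact hx

theorem isMulCommutative_of_isSolvable (c : ChiefFactor G) [Group.IsSolvable c.Carrier] :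
    IsMulCommutative c.Carrier := by
  rcases c.eq_bot_or_eq_top_of_invariant (commutator c.Carrier) fun g w hw => by
    have : (commutator c.Carrier).map (c.action g).toMonoidHom ≤ commutator c.Carrier :=
      (Subgroup.characteristic_iff_map_le.1 inferInstance) (c.action g)
    exact this ⟨w, hw, rfl⟩ with h | h
  · refine ⟨⟨fun a b => ?_⟩⟩
    have hb : b ∈ Subgroup.center c.Carrier :=
      (commutator_eq_bot_iff_center_eq_top _).1 h ▸ Subgroup.mem_top b
    exact Subgroup.mem_center_iff.1 hb a
  · exact absurd h (Group.IsSolvable.commutator_lt_top_of_nontrivial c.Carrier).ne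

end ChiefFactor

theorem isSolvable_sup {G : Type u} [Group G] (M N : Subgroup G) [N.Normal]
    [Group.IsSolvable M] [Group.IsSolvable N] : Group.IsSolvable ↥(M ⊔ N) := by
  have : Group.IsSolvable (M.map (QuotientGroup.mk' N)) :=
    Group.isSolvable_of_surjective ((QuotientGroup.mk' N).subgroupMap_surjective M)
  have hmem (x : ↥(M ⊔ N)) : QuotientGroup.mk' N x ∈ M.map (QuotientGroup.mk' N) := by
    obtain ⟨m, hm, n, hn, hx⟩ := Subgroup.mem_sup_of_normal_right.1 x.2
    refine ⟨m, hm, ?_⟩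
    rw [← hx]
    exact (QuotientGroup.mk_mul_of_mem m hn).symm
  refine Group.isSolvable_of_ker_le_range (Subgroup.inclusion (le_sup_right : N ≤ M ⊔ N))
    (((QuotientGroup.mk' N).comp (M ⊔ N).subtype).codRestrict _ hmem) fun x hx => ?_
  have hx' : (x : G) ∈ N := (QuotientGroup.eq_one_iff _).1 (congrArg Subtype.val hx)
  exact ⟨⟨x, hx'⟩, rfl⟩

instance isSolvable_solubleRadical (G : Type u) [Group G] [Finite G] :
    Group.IsSolvable (solubleRadical G) := by
  obtain ⟨M, ⟨hM, hMs⟩, hmax⟩ := exists_maximal_of_wellFoundedGT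
    (fun M : Subgroup G => M.Normal ∧ Group.IsSolvable M) ⟨⊥, inferInstance, inferInstance⟩
  have hle : solubleRadical G ≤ M := sSup_le fun N ⟨hN, hNs⟩ =>
    le_sup_right.trans (hmax ⟨inferInstance, isSolvable_sup M N⟩ le_sup_left)
  exact Group.isSolvable_of_isSolvable_injective (Subgroup.inclusion_injective hle)

theorem ChiefFactor.inf_solubleRadical_le {G : Type u} [Group G] [Finite G] (c : ChiefFactor G)
    (h : ¬ IsMulCommutative c.Carrier) : c.top ⊓ solubleRadical G ≤ c.bot := by
  by_contra h'
  obtain ⟨e⟩ := (c.inf_similar _ h').nonempty_mulEquiv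
  have : Group.IsSolvable (c.inf _ h').top :=
    Group.isSolvable_of_isSolvable_injective
      (Subgroup.inclusion_injective (inf_le_right : c.top ⊓ solubleRadical G ≤ solubleRadical G))
  have : Group.IsSolvable c.Carrier := Group.isSolvable_of_surjective (f := e.toMonoidHom)
    e.surjective
  exact h c.isMulCommutative_of_isSolvable

/-! ### Canonical composition definitions -/

/-- A class `Y = 𝔑_p Y` contains every extension of a `p`-group by a member of `Y`. -/
theorem IsFormation.of_normal_pSubgroup {Y : GroupClass.{u}} (hY : IsFormation Y) {p : ℕ}
    (hp : Y = pGroupsBy p Y) {G H : Type u} [Group G] [Group H] [Finite G] {f : G →* H}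
    (hf : Function.Surjective f) (hker : IsPGroup p f.ker) (h : Y H) : Y G := by
  rw [hp]
  exact ⟨inferInstance, hY.quotient_of_le (M := f.ker) (N := pCore p G)
    (le_sSup ⟨inferInstance, hker⟩)
    (hY.mulEquiv (QuotientGroup.quotientKerEquivOfSurjective f hf).symm h)⟩

namespace ChiefFactor

variable {G : Type u} [Group G]

/-- The chief factor `H/K`, as a minimal normal subgroup of `(H/K) ⋊ G/C_G(H/K)`. -/
def socleFactor (c : ChiefFactor G) : ChiefFactor c.SemidirectProd where
  top := (SemidirectProduct.inl : c.Carrier →* c.SemidirectProd).range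
  bot := ⊥
  top_normal := by
    rw [SemidirectProduct.range_inl_eq_ker_rightHom]
    infer_instance
  bot_normal := inferInstance
  lt := by
    obtain ⟨a, ha⟩ := exists_ne (1 : c.Carrier)
    refine bot_lt_iff_ne_bot.2 fun h => ha ?_
    have : SemidirectProduct.inl a ∈
      (SemidirectProduct.inl : c.Carrier →* c.SemidirectProd).range := ⟨a, rfl⟩
    rw [h, Subgroup.mem_bot] at this
    exact SemidirectProduct.inl_injective this
  eq_or_eq L hL _ h₂ := by
    have hL' : L = (L.comap SemidirectProduct.inl).map SemidirectProduct.inl := by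
      rw [Subgroup.map_comap_eq, inf_eq_right.2 h₂]
    rcases c.eq_bot_or_eq_top_of_invariant (L.comap SemidirectProduct.inl) fun g w hw => by
      change SemidirectProduct.inl (QuotientGroup.kerLift c.action (g : G ⧸ c.centralizer) w) ∈ L
      rw [SemidirectProduct.inl_aut, map_inv]
      exact hL.conj_mem _ hw _ with h | h
    · left; rw [hL', h, Subgroup.map_bot]
    · right; rw [hL', h, MonoidHom.range_eq_map]

theorem isAbelianPFactor_socleFactor {c : ChiefFactor G} {p : ℕ} (hc : c.IsAbelianPFactor p) :
    c.socleFactor.IsAbelianPFactor p := by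
  let q : c.Carrier →* c.socleFactor.Carrier := (QuotientGroup.mk' _).comp
    (SemidirectProduct.inl : c.Carrier →* c.SemidirectProd).rangeRestrict
  have hq : Function.Surjective q :=
    (QuotientGroup.mk'_surjective _).comp (MonoidHom.rangeRestrict_surjective _)
  refine ⟨⟨⟨fun x y => ?_⟩⟩, hc.2.of_surjective q hq⟩
  obtain ⟨x, rfl⟩ := hq x
  obtain ⟨y, rfl⟩ := hq y
  rw [← map_mul, hc.1.is_comm.comm x y, map_mul]

theorem centralizer_socleFactor_le {c : ChiefFactor G} (hc : IsMulCommutative c.Carrier) :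
    c.socleFactor.centralizer ≤
      (SemidirectProduct.rightHom : c.SemidirectProd →* G ⧸ c.centralizer).ker := by
  intro x hx
  rw [mem_centralizer] at hx
  have hright : QuotientGroup.kerLift c.action x.right = 1 := by
    ext w
    have h := hx (SemidirectProduct.inl w) ⟨w, rfl⟩
    have h' : (SemidirectProduct.inl w)⁻¹ * (x * SemidirectProduct.inl w * x⁻¹) = 1 := h
    rw [inv_mul_eq_one, eq_mul_inv_iff_mul_eq] at h'
    have h'' := congrArg SemidirectProduct.left h'
    simp only [SemidirectProduct.mul_left, SemidirectProduct.left_inl,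
      SemidirectProduct.right_inl, map_one, MulAut.one_apply] at h''
    rw [hc.is_comm.comm, mul_right_inj] at h''
    exact h''.symm
  exact QuotientGroup.kerLift_injective c.action (hright.trans (map_one _).symm)

end ChiefFactor

section Canonical

variable {X : GroupClass.{u}} {F : CompositionFunction.{u}} {G : Type u} [Group G]

/-- For a canonical definition, centrality of an abelian `p`-chief factor is decided by the group
of automorphisms induced on it. -/
theorem IsCanonicalDefinition.isCentral_iff (hF : IsCanonicalDefinition F X) [Finite G]
    {c : ChiefFactor G} {p : Nat.Primes} (hc : c.IsAbelianPFactor p) :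
    c.IsCentral X ↔ F.prime p (G ⧸ c.centralizer) := by
  have hY := hF.isCompositionDefinition.2 p
  constructor
  · intro h
    rw [ChiefFactor.IsCentral, hF.eq_clf] at h
    exact hY.of_surjective_of_ker_le SemidirectProduct.rightHom_surjective
      (ChiefFactor.centralizer_socleFactor_le hc.1)
      (h.2.2 p _ (ChiefFactor.isAbelianPFactor_socleFactor hc))
  · intro h
    have : Finite c.SemidirectProd := Finite.of_equiv _ SemidirectProduct.equivProd.symm
    refine hF.prime_subclass p _ (hY.of_normal_pSubgroup (hF.prime_eq p)
      SemidirectProduct.rightHom_surjective ?_ h)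
    rw [← SemidirectProduct.range_inl_eq_ker_rightHom]
    exact hc.2.of_surjective _ (MonoidHom.rangeRestrict_surjective _)

theorem withRank_eq_clf (hX : IsFormation X) (hN : nilpotentGroups.Subclass X)
    (hF : IsCanonicalDefinition F X) (R : GeneralizedRankFunction.{u}) :
    X.withRank R = CompositionFunction.clf ⟨X.withRank R, F.prime⟩ := by
  funext G _
  refine propext ⟨fun hG => ?_, fun ⟨hfin, h₀, hp⟩ => ⟨hfin, fun c => ?_⟩⟩
  · have := hG.1
    refine ⟨hG.1, (isFormation_withRank hX).image _ _ _
      (QuotientGroup.mk'_surjective (solubleRadical G)) hG, fun p c hc => ?_⟩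
    have := Fact.mk p.2
    have hXc : X c.Carrier := hN _ ⟨inferInstance, hc.2.isNilpotent⟩
    exact (hF.isCentral_iff hc).1 (by_contra fun h => (hG.2 c h).1 hXc)
  · by_cases hc : IsMulCommutative c.Carrier
    · obtain ⟨p, hcp⟩ := c.exists_isAbelianPFactor hc
      exact fun h => (h ((hF.isCentral_iff hcp).2 (hp p c hcp))).elim
    · refine (c.similar_sup _ (c.inf_solubleRadical_le hc)).symm.isAdmissible hX
        (isAdmissible_of_ker_le hX h₀ (QuotientGroup.mk' _) (QuotientGroup.mk'_surjective _) _ ?_)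
      rw [QuotientGroup.ker_mk']
      exact le_sup_right

theorem isCanonicalDefinition_withRank (hX : IsFormation X) (hN : nilpotentGroups.Subclass X)
    (hF : IsCanonicalDefinition F X) (R : GeneralizedRankFunction.{u}) :
    IsCanonicalDefinition ⟨X.withRank R, F.prime⟩ (X.withRank R) where
  isCompositionDefinition := ⟨isFormation_withRank hX, hF.isCompositionDefinition.2⟩
  eq_clf := withRank_eq_clf hX hN hF R
  prime_eq := hF.prime_eq
  prime_subclass p G _ hG := hX.subclass_withRank G (hF.prime_subclass p G hG)
  zero_eq := rfl

end Canonical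

/-! ### Uniqueness of the canonical composition definition -/

theorem conj_pow_eq {G : Type u} [Group G] {z b w : G} (hz : z * w = w * z)
    (h : z * b * z⁻¹ = b * w) (n : ℕ) : z ^ n * b * (z ^ n)⁻¹ = b * w ^ n := by
  induction n with
  | zero => simp
  | succ n ih =>
    have hz' : z * w ^ n * z⁻¹ = w ^ n :=
      mul_inv_eq_of_eq_mul (Commute.pow_right (show Commute z w from hz) n)
    calc z ^ (n + 1) * b * (z ^ (n + 1))⁻¹ = z * (z ^ n * b * (z ^ n)⁻¹) * z⁻¹ := by
          rw [pow_succ']; group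
      _ = (z * b * z⁻¹) * (z * w ^ n * z⁻¹) := by rw [ih]; group
      _ = b * w ^ (n + 1) := by rw [h, hz', pow_succ', mul_assoc]

/-- An element that centralizes all chief factors below a normal subgroup `L` of exponent `p` has a
`p`-power that centralizes `L`. -/
theorem exists_pow_centralizes {G : Type u} [Group G] [Finite G] {p : ℕ} {x : G}
    (L : Subgroup G) (hL : L.Normal) (hLp : ∀ b ∈ L, b ^ p = 1)
    (hx : ∀ c : ChiefFactor G, c.top ≤ L → x ∈ c.centralizer) :
    ∃ m : ℕ, ∀ b ∈ L, x ^ p ^ m * b = b * x ^ p ^ m := by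
  induction L using WellFoundedLT.induction with | _ L ih =>
  by_cases hbot : L = ⊥
  · refine ⟨0, fun b hb => ?_⟩
    rw [hbot, Subgroup.mem_bot] at hb
    simp [hb]
  obtain ⟨c, rfl, -⟩ := ChiefFactor.exists_top_eq ⊥ L (bot_lt_iff_ne_bot.2 hbot)
  obtain ⟨m, hm⟩ := ih c.bot c.lt c.bot_normal (fun b hb => hLp b (c.lt.le hb))
    fun d hd => hx d (hd.trans c.lt.le)
  refine ⟨m + 1, fun b hb => ?_⟩
  have hz := (c.mem_centralizer _).1 (pow_mem (hx c le_rfl) (p ^ m)) b hb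
  have := conj_pow_eq (hm _ hz) (b := b) (by group) p
  rw [hLp _ (c.lt.le hz), mul_one, ← pow_mul, ← pow_succ, mul_inv_eq_iff_eq_mul] at this
  exact this

/-- If `G ∈ D(p)`, then the wreath product of the group of order `p` with `G` lies in `D(p)`, hence
in `X`, and its chief factors below the base group force it into `D'(p)`. -/
theorem IsCanonicalDefinition.prime_subclass_prime {X : GroupClass.{u}}
    {D D' : CompositionFunction.{u}} (hD : IsCanonicalDefinition D X)
    (hD' : IsCanonicalDefinition D' X) (p : Nat.Primes) :
    (D.prime p).Subclass (D'.prime p) := by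
  intro G _ hG
  have hY := hD.isCompositionDefinition.2 p
  have hY' := hD'.isCompositionDefinition.2 p
  have := hY.finite G hG
  have hp : Fact (p : ℕ).Prime := ⟨p.2⟩
  classical
  let Z := Multiplicative (ZMod p)
  have : Finite Z := inferInstanceAs (Finite (ZMod p))
  let W := (G → Z) ⋊[(mulAutArrow : G →* MulAut (G → Z))] G
  have hfin : Finite W := Finite.of_equiv _ SemidirectProduct.equivProd.symm
  let B : Subgroup W := (SemidirectProduct.rightHom : W →* G).ker
  have hB (b : W) (hb : b ∈ B) : ∃ f : G → Z, SemidirectProduct.inl f = b := by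
    change b ∈ (SemidirectProduct.inl : (G → Z) →* W).range
    rw [SemidirectProduct.range_inl_eq_ker_rightHom]
    exact hb
  have hcomm (a b : W) (ha : a ∈ B) (hb : b ∈ B) : a * b = b * a := by
    obtain ⟨f, rfl⟩ := hB a ha
    obtain ⟨g, rfl⟩ := hB b hb
    rw [← map_mul, mul_comm, map_mul]
  have hpow (b : W) (hb : b ∈ B) : b ^ (p : ℕ) = 1 := by
    obtain ⟨f, rfl⟩ := hB b hb
    rw [← map_pow]
    have : f ^ (p : ℕ) = 1 := by
      funext x
      exact (nsmul_eq_mul (p : ℕ) (f x).toAdd).trans (by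
        rw [ZMod.natCast_self, zero_mul]
        rfl)
    rw [this, map_one]
  have hBp : IsPGroup p B := fun b => ⟨1, by
    ext1
    simpa using hpow b b.2⟩
  have hW : D.prime p W :=
    hY.of_normal_pSubgroup (hD.prime_eq p) SemidirectProduct.rightHom_surjective hBp hG
  have hWX : D'.clf W := hD'.eq_clf ▸ hD.prime_subclass p W hW
  have hfac (c : ChiefFactor W) (hc : c.top ≤ B) : D'.prime p (W ⧸ c.centralizer) := by
    refine hWX.2.2 p c ⟨⟨⟨?_⟩⟩, ?_⟩
    · rintro ⟨a⟩ ⟨b⟩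
      exact congrArg (QuotientGroup.mk' _)
        (Subtype.ext (hcomm a b (hc a.2) (hc b.2)) : a * b = b * a)
    · exact (hBp.of_injective _ (Subgroup.inclusion_injective hc)).of_surjective
        (QuotientGroup.mk' _) (QuotientGroup.mk'_surjective _)
  have hBbot : ⊥ < B := by
    refine bot_lt_iff_ne_bot.2 fun h => ?_
    obtain ⟨f, hf⟩ := exists_ne (1 : G → Z)
    have : SemidirectProduct.inl f ∈ B := SemidirectProduct.rightHom_inl f
    rw [h, Subgroup.mem_bot] at this
    exact hf (SemidirectProduct.inl_injective this)
  obtain ⟨c, hc, -⟩ := ChiefFactor.exists_top_eq ⊥ B hBbot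
  -- The `D'(p)`-residual `M` of the wreath product centralizes the chief factors below the base
  -- group `B`. So a `p`-power of each of its elements lies in `B`, and `M` is a `p`-group.
  obtain ⟨M, _, hM, hmin⟩ := hY'.exists_residual ⟨_, _, hfac c hc.le⟩
  -- The base group contains its centralizer.
  have hself (x : W) (hx : ∀ b ∈ B, x * b = b * x) : x ∈ B := by
    let f : G → Z := Pi.mulSingle 1 (Multiplicative.ofAdd 1)
    have h : x.left * mulAutArrow x.right f = f * mulAutArrow (1 : G) x.left :=
      congrArg SemidirectProduct.left
        (hx (SemidirectProduct.inl f) (SemidirectProduct.rightHom_inl f))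
    rw [map_one, MulAut.one_apply, mul_comm, mul_left_inj] at h
    have h' : f (x.right⁻¹ * x.right) = f x.right := congrFun h x.right
    rw [inv_mul_cancel] at h'
    by_contra hne
    have hne' : x.right ≠ 1 := hne
    rw [show f 1 = _ from Pi.mulSingle_eq_same _ _,
      show f x.right = _ from Pi.mulSingle_eq_of_ne hne' _] at h'
    exact one_ne_zero (α := ZMod p) h'
  have hMp : IsPGroup p M := by
    intro x
    obtain ⟨m, hm⟩ := exists_pow_centralizes (x := (x : W)) B inferInstance hpow
      fun c hc => hmin _ (hfac c hc) x.2
    refine ⟨m + 1, ?_⟩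
    ext1
    rw [pow_succ, pow_mul]
    exact hpow _ (hself _ hm)
  have hW' : D'.prime p W := hY'.of_normal_pSubgroup (hD'.prime_eq p)
    (QuotientGroup.mk'_surjective M) (by rwa [QuotientGroup.ker_mk']) hM
  exact hY'.image W G SemidirectProduct.rightHom SemidirectProduct.rightHom_surjective hW'

theorem IsCanonicalDefinition.unique {X : GroupClass.{u}} {D D' : CompositionFunction.{u}}
    (hD : IsCanonicalDefinition D X) (hD' : IsCanonicalDefinition D' X) : D = D' := by
  refine CompositionFunction.ext (hD.zero_eq.trans hD'.zero_eq.symm) ?_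
  funext p G _
  exact propext ⟨hD.prime_subclass_prime hD' p G, hD'.prime_subclass_prime hD p G⟩

/-! ### Chief factors of a normal subgroup -/

namespace ChiefFactor

variable {G : Type u} [Group G] {N : Subgroup G}

/-- The chief factor `d` of the normal subgroup `N` is a section of the chief factor `c` of `G`. -/
structure LiesIn (d : ChiefFactor N) (c : ChiefFactor G) : Prop where
  top_le : c.top ≤ N
  bot_le : c.bot.subgroupOf N ≤ d.bot
  le_top : d.top ≤ c.top.subgroupOf N

/-- A consequence of the Jordan–Hölder theorem for chief series of `G` through `N`. -/
theorem exists_similar_liesIn [Finite G] [hN : N.Normal] (d : ChiefFactor N) :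
    ∃ (c : ChiefFactor G) (d' : ChiefFactor N), d'.Similar d ∧ d'.LiesIn c := by
  obtain ⟨L, ⟨hL, hLN, hd⟩, hmin⟩ := exists_minimal_of_wellFoundedLT
    (fun L : Subgroup G => L.Normal ∧ L ≤ N ∧ ¬ d.top ⊓ L.subgroupOf N ≤ d.bot)
    ⟨N, hN, le_rfl, by simpa using d.lt.not_ge⟩
  have hbot : ⊥ < L := bot_lt_iff_ne_bot.2 fun h => hd (by simp [h])
  obtain ⟨c, rfl, -⟩ := exists_top_eq ⊥ L hbot
  have hc : d.top ⊓ c.bot.subgroupOf N ≤ d.bot := by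
    by_contra h
    exact c.lt.not_ge (hmin ⟨c.bot_normal, c.lt.le.trans hLN, h⟩ c.lt.le)
  have hc' : (d.inf _ hd).top ⊓ c.bot.subgroupOf N ≤ (d.inf _ hd).bot :=
    fun x hx => ⟨hc ⟨hx.1.1, hx.2⟩, hx.1.2⟩
  exact ⟨c, (d.inf _ hd).sup _ hc', ((d.inf _ hd).similar_sup _ hc').symm.trans
    (d.inf_similar _ hd), hLN, le_sup_right,
    sup_le inf_le_right (Subgroup.comap_mono c.lt.le)⟩

/-- Chief factors of `N` in an `X`-central chief factor of `G` are `X`-central. The elements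
`x`, `y`, `z` of `N` with `x ≡ y` modulo the top of `d` and `y ≡ z` modulo the top of `c` form
a group; the semidirect product of `d` is its image on `(x, y)`, and that of `c` contains its images
on `(x, z)` and `(y, z)` as a normal subgroup. -/
theorem LiesIn.isCentral [Finite G] [N.Normal] {X : GroupClass.{u}} (hX : IsFormation X)
    (hX' : IsNormallyHereditary X) {d : ChiefFactor N} {c : ChiefFactor G} (h : d.LiesIn c)
    (hc : c.IsCentral X) : d.IsCentral X := by
  let Z : Subgroup (N × N × N) :=
    (congruentPairs d.top).comap ((MonoidHom.fst N (N × N)).prod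
      ((MonoidHom.fst N N).comp (MonoidHom.snd N (N × N)))) ⊓
    (congruentPairs (c.top.subgroupOf N)).comap (MonoidHom.snd N (N × N))
  have hxy (w : Z) : w.1.1 * w.1.2.1⁻¹ ∈ d.top := w.2.1
  have hyz (w : Z) : (w.1.2.1 * w.1.2.2⁻¹ : G) ∈ c.top := w.2.2
  have hxz (w : Z) : (w.1.1 * w.1.2.2⁻¹ : G) ∈ c.top := by
    have hxy' : (w.1.1 * w.1.2.1⁻¹ : G) ∈ c.top := h.le_top (hxy w)
    simpa using mul_mem hxy' (hyz w)
  let j₁ : Z →* congruentPairs c.top :=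
    { toFun := fun w => ⟨(w.1.1, w.1.2.2), hxz w⟩
      map_one' := rfl
      map_mul' := fun _ _ => rfl }
  let j₂ : Z →* congruentPairs c.top :=
    { toFun := fun w => ⟨(w.1.2.1, w.1.2.2), hyz w⟩
      map_one' := rfl
      map_mul' := fun _ _ => rfl }
  let j : Z →* congruentPairs d.top :=
    { toFun := fun w => ⟨(w.1.1, w.1.2.1), hxy w⟩
      map_one' := rfl
      map_mul' := fun _ _ => rfl }
  have hdiag (a : N) : a * a⁻¹ ∈ d.top := by simp
  have hj : Function.Surjective j := by
    rintro ⟨⟨x, y⟩, hxy⟩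
    exact ⟨⟨(x, y, y), hxy, by simp [mem_congruentPairs]⟩, rfl⟩
  let P : Subgroup (congruentPairs c.top) := (N.prod N).subgroupOf _
  have hQ : X (P.map c.pairHom) :=
    hX' _ _ (Subgroup.Normal.map inferInstance _ c.pairHom_surjective) hc
  have h₁ : j₁.range = P := by
    ext ⟨⟨a, b⟩, hab⟩
    constructor
    · rintro ⟨w, hw⟩
      have hw' := congrArg Subtype.val hw
      rw [Subgroup.mem_subgroupOf, ← hw']
      exact ⟨w.1.1.2, w.1.2.2.2⟩
    · rintro ⟨ha, hb⟩
      exact ⟨⟨(⟨a, ha⟩, ⟨a, ha⟩, ⟨b, hb⟩), hdiag _, hab⟩, rfl⟩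
  have h₂ : j₂.range = P := by
    ext ⟨⟨a, b⟩, hab⟩
    constructor
    · rintro ⟨w, hw⟩
      have hw' := congrArg Subtype.val hw
      rw [Subgroup.mem_subgroupOf, ← hw']
      exact ⟨w.1.2.1.2, w.1.2.2.2⟩
    · rintro ⟨ha, hb⟩
      exact ⟨⟨(⟨a, ha⟩, ⟨a, ha⟩, ⟨b, hb⟩), hdiag _, hab⟩, rfl⟩
  refine hX.subdirect (f₁ := c.pairHom.comp j₁) (f₂ := c.pairHom.comp j₂)
    (by rwa [MonoidHom.range_comp, h₁]) (by rwa [MonoidHom.range_comp, h₂])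
    (f := d.pairHom.comp j) (d.pairHom_surjective.comp hj) fun w hw₁ hw₂ => ?_
  obtain ⟨hw₁, hz⟩ := (c.pairHom_eq_one_iff _).1 hw₁
  obtain ⟨hw₂, -⟩ := (c.pairHom_eq_one_iff _).1 hw₂
  have hz' : w.1.2.2 ∈ d.centralizer := (d.mem_centralizer _).2 fun a ha =>
    h.bot_le ((c.mem_centralizer _).1 hz a (h.le_top ha))
  have hb₁ : w.1.1 * w.1.2.2⁻¹ ∈ d.bot := h.bot_le hw₁
  have hb₂ : w.1.2.1 * w.1.2.2⁻¹ ∈ d.bot := h.bot_le hw₂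
  refine (d.pairHom_eq_one_iff _).2 ⟨?_, ?_⟩
  · change w.1.1 * w.1.2.1⁻¹ ∈ d.bot
    simpa using mul_mem hb₁ (inv_mem hb₂)
  · change w.1.2.1 ∈ d.centralizer
    rw [← inv_mul_cancel_right w.1.2.1 w.1.2.2]
    exact mul_mem (d.bot_le_centralizer hb₂) hz'

/-- The map from the top of a chief factor of `N` to the chief factor of `G` in which it lies. -/
def LiesIn.hom {d : ChiefFactor N} {c : ChiefFactor G} (h : d.LiesIn c) : d.top →* c.Carrier :=
  (QuotientGroup.mk' _).comp
    ((N.subtype.comp d.top.subtype).codRestrict c.top fun x => h.le_top x.2)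

theorem LiesIn.hom_eq_one_iff {d : ChiefFactor N} {c : ChiefFactor G} (h : d.LiesIn c)
    (x : d.top) : h.hom x = 1 ↔ x.1 ∈ c.bot.subgroupOf N :=
  c.mk_eq_one_iff _

theorem LiesIn.normal_range_hom {d : ChiefFactor N} {c : ChiefFactor G} (h : d.LiesIn c) :
    h.hom.range.Normal := by
  refine ⟨?_⟩
  rintro _ ⟨x, rfl⟩ ⟨g⟩
  exact ⟨MulAut.conjNormal (⟨g, h.top_le g.2⟩ : N) x, rfl⟩

theorem LiesIn.inducesInner [N.Normal] {d : ChiefFactor N} {c : ChiefFactor G} (h : d.LiesIn c)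
    (hc : c.InducesInner) : d.InducesInner :=
  hc.of_section (α := h.hom) (ψ := QuotientGroup.mk' _) h.normal_range_hom.isSubnormal
    (QuotientGroup.mk'_surjective _)
    (fun x hx => (d.mk_eq_one_iff x).2 (h.bot_le ((h.hom_eq_one_iff x).1 hx)))
    fun y => ⟨y, MulAut.conjNormal y, fun _ => rfl, fun _ => rfl⟩

/-! ### Clifford theory of chief factors -/

/-- The property that all chief factors between `K` and `L` are isomorphic to `M` is inherited by
joins of normal subgroups `L`. -/
theorem nonempty_mulEquiv_of_top_le_sup {Γ M : Type u} [Group Γ] [Group M] {K L₁ L₂ : Subgroup Γ}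
    [L₁.Normal] [L₂.Normal] (hK₁ : K ≤ L₁) (hK₂ : K ≤ L₂)
    (h₁ : ∀ e : ChiefFactor Γ, K ≤ e.bot → e.top ≤ L₁ → Nonempty (e.Carrier ≃* M))
    (h₂ : ∀ e : ChiefFactor Γ, K ≤ e.bot → e.top ≤ L₂ → Nonempty (e.Carrier ≃* M))
    (e : ChiefFactor Γ) (hK : K ≤ e.bot) (he : e.top ≤ L₁ ⊔ L₂) : Nonempty (e.Carrier ≃* M) := by
  by_cases h : e.top ⊓ L₁ ≤ e.bot
  · obtain ⟨f⟩ := (e.similar_sup L₁ h).nonempty_mulEquiv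
    have h' : ¬ (e.sup L₁ h).top ⊓ L₂ ≤ (e.sup L₁ h).bot := fun h' => by
      refine (e.sup L₁ h).lt.not_ge fun x hx => ?_
      have hL₁ : L₁ ≤ (e.sup L₁ h).bot := le_sup_right
      obtain ⟨a, ha, b, hb, rfl⟩ :=
        Subgroup.mem_sup_of_normal_right.1 (sup_le he le_sup_left hx)
      exact mul_mem (hL₁ ha) (h' ⟨(Subgroup.mul_mem_cancel_left _
        ((e.sup L₁ h).lt.le (hL₁ ha))).1 hx, hb⟩)
    obtain ⟨f'⟩ := ((e.sup L₁ h).inf_similar L₂ h').nonempty_mulEquiv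
    obtain ⟨f''⟩ := h₂ ((e.sup L₁ h).inf L₂ h') (le_inf (hK.trans le_sup_left) hK₂) inf_le_right
    exact ⟨(f.trans f'.symm).trans f''⟩
  · obtain ⟨f⟩ := (e.inf_similar L₁ h).nonempty_mulEquiv
    obtain ⟨f'⟩ := h₁ (e.inf L₁ h) (le_inf hK hK₁) inf_le_right
    exact ⟨f.symm.trans f'⟩

/-- All chief factors of `N` in a chief factor `c` of `G` are isomorphic groups. The largest
subgroup below which all of them are isomorphic to a given minimal one is invariant under `G`. -/
theorem LiesIn.nonempty_mulEquiv [Finite G] [N.Normal] {c : ChiefFactor G} {m d : ChiefFactor N}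
    (hm : m.LiesIn c) (hbot : m.bot = c.bot.subgroupOf N) (hd : d.LiesIn c) :
    Nonempty (d.Carrier ≃* m.Carrier) := by
  obtain ⟨L, ⟨hLn, hKL, hLH, hL⟩, hmax⟩ := exists_maximal_of_wellFoundedGT
    (fun L : Subgroup N => L.Normal ∧ c.bot.subgroupOf N ≤ L ∧ L ≤ c.top.subgroupOf N ∧
      ∀ e : ChiefFactor N, c.bot.subgroupOf N ≤ e.bot → e.top ≤ L →
        Nonempty (e.Carrier ≃* m.Carrier))
    ⟨c.bot.subgroupOf N, inferInstance, le_rfl, Subgroup.comap_mono c.lt.le,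
      fun e h₁ h₂ => absurd (h₂.trans h₁) e.lt.not_ge⟩
  have hle {L' : Subgroup N} (hn : L'.Normal) (h₁ : c.bot.subgroupOf N ≤ L')
      (h₂ : L' ≤ c.top.subgroupOf N)
      (h₃ : ∀ e : ChiefFactor N, c.bot.subgroupOf N ≤ e.bot → e.top ≤ L' →
        Nonempty (e.Carrier ≃* m.Carrier)) : L' ≤ L :=
    le_sup_right.trans (hmax ⟨inferInstance, hKL.trans le_sup_left, sup_le hLH h₂,
      nonempty_mulEquiv_of_top_le_sup hKL h₁ hL h₃⟩ le_sup_left)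
  have hmL : m.top ≤ L := hle m.top_normal (hbot ▸ m.lt.le) hm.le_top fun e h₁ h₂ => by
    have hem : e.bot = m.bot ∧ e.top = m.top := by
      rcases m.eq_or_eq e.bot e.bot_normal (hbot ▸ h₁) (e.lt.le.trans h₂) with h | h
      · exact ⟨h, (m.eq_or_eq e.top e.top_normal (h ▸ e.lt.le) h₂).resolve_left
          fun h' => e.lt.ne (h.trans h'.symm)⟩
      · exact absurd (h ▸ h₂) e.lt.not_ge
    rw [ChiefFactor.ext hem.2 hem.1]
    exact ⟨MulEquiv.refl _⟩
  have hconj (g : G) (x : N) (hx : x ∈ L) : MulAut.conjNormal g x ∈ L := by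
    -- The preimage of `L` under conjugation by `g⁻¹` has the property that defines `L`.
    let α : N →* N := (MulAut.conjNormal g⁻¹ : MulAut N).toMonoidHom
    have hα : Function.Surjective α := (MulAut.conjNormal g⁻¹ : MulAut N).surjective
    have hker : α.ker = ⊥ := (MonoidHom.ker_eq_bot_iff α).2
      (MulAut.conjNormal g⁻¹ : MulAut N).injective
    have hinv (T : Subgroup G) (hT : T.Normal) (x : N) (hx : (x : G) ∈ T) : (α x : G) ∈ T := by
      have := hT.conj_mem x hx g⁻¹
      simpa [α] using this
    have hinv' (T : Subgroup G) (hT : T.Normal) (x : N) (hx : (α x : G) ∈ T) : (x : G) ∈ T := by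
      have := hT.conj_mem (α x) hx g
      simpa [α, mul_assoc] using this
    refine hle (L' := L.comap α) inferInstance
      (fun x hx => hKL (hinv _ c.bot_normal x hx))
      (fun x hx => hinv' _ c.top_normal x (hLH hx)) (fun e h₁ h₂ => ?_) ?_
    · obtain ⟨f⟩ := (e.similar_map α hα (hker.trans_le _root_.bot_le)).nonempty_mulEquiv
      obtain ⟨f'⟩ := hL (e.map α hα (hker.trans_le _root_.bot_le)) (fun x hx => by
        obtain ⟨y, rfl⟩ := hα x
        exact ⟨y, h₁ (hinv' _ c.bot_normal y hx), rfl⟩) (Subgroup.map_le_iff_le_comap.2 h₂)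
      exact ⟨f.trans f'⟩
    · have : α (MulAut.conjNormal g x) = x := by
        ext
        simp [α]
      rwa [Subgroup.mem_comap, this]
  refine hL d hd.bot_le (hd.le_top.trans fun x hx => ?_)
  have hTn : (L.map N.subtype).Normal := by
    refine ⟨?_⟩
    rintro _ ⟨y, hy, rfl⟩ g
    exact ⟨_, hconj g y hy, by simp⟩
  rcases c.eq_or_eq (L.map N.subtype) hTn
    (fun y hy => ⟨⟨y, hd.top_le (c.lt.le hy)⟩, hKL hy, rfl⟩)
    (by rintro _ ⟨y, hy, rfl⟩; exact hLH hy) with h | h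
  · refine absurd (fun y hy => ?_) m.lt.not_ge
    rw [hbot, Subgroup.mem_subgroupOf, ← h]
    exact ⟨y, hmL hy, rfl⟩
  · have hx' : (x : G) ∈ L.map N.subtype := h.symm ▸ hx
    obtain ⟨y, hy, hyx⟩ := hx'
    exact Subtype.ext hyx ▸ hy

theorem card_top {Γ : Type u} [Group Γ] (e : ChiefFactor Γ) :
    Nat.card e.top = Nat.card e.Carrier * Nat.card e.bot := by
  rw [Subgroup.card_eq_card_quotient_mul_card_subgroup (e.bot.subgroupOf e.top),
    Nat.card_congr (Subgroup.subgroupOfEquivOfLe e.lt.le).toEquiv]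

/-- If all chief factors between `K` and `L` have order `q`, then the index of `K` in `L` is a power
of `q`. -/
theorem exists_card_eq_mul_pow {Γ : Type u} [Group Γ] [Finite Γ] {K : Subgroup Γ} [K.Normal]
    {q : ℕ} (L : Subgroup Γ) (hLn : L.Normal) (hKL : K ≤ L)
    (h : ∀ e : ChiefFactor Γ, K ≤ e.bot → e.top ≤ L → Nat.card e.Carrier = q) :
    ∃ j : ℕ, Nat.card L = Nat.card K * q ^ j := by
  induction L using WellFoundedLT.induction with | _ L ih =>
  rcases hKL.eq_or_lt with rfl | hlt
  · exact ⟨0, by simp⟩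
  obtain ⟨e, rfl, he⟩ := exists_top_eq K L hlt
  obtain ⟨j, hj⟩ := ih e.bot e.lt e.bot_normal he fun d h₁ h₂ => h d h₁ (h₂.trans e.lt.le)
  exact ⟨j + 1, by rw [e.card_top, hj, h e he le_rfl]; ring⟩

end ChiefFactor

/-! ### Normal subgroups of powers of non-abelian simple groups -/

/-- A normal subgroup of a direct power of a non-abelian simple group is the product of the factors
on which it projects non-trivially. -/
theorem exists_mulEquiv_pi_of_normal {S ι : Type*} [Group S] [IsSimpleGroup S] [Finite ι]
    (hS : ¬ IsMulCommutative S) (W : Subgroup (ι → S)) [hW : W.Normal] :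
    ∃ k : ℕ, Nonempty (W ≃* (Fin k → S)) := by
  classical
  have hcenter : Subgroup.center S = ⊥ :=
    (Subgroup.Normal.eq_bot_or_eq_top inferInstance).resolve_right fun h =>
      hS ⟨⟨fun a b => Subgroup.mem_center_iff.1 (h ▸ Subgroup.mem_top b) a⟩⟩
  let J : Set ι := {i | ∃ w ∈ W, w i ≠ 1}
  have hsingle (i : ι) (hi : i ∈ J) (s : S) : Pi.mulSingle i s ∈ W := by
    obtain ⟨w, hw, hwi⟩ := hi
    have hn : (W.comap (MonoidHom.mulSingle (fun _ : ι => S) i)).Normal := hW.comap _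
    have htop : W.comap (MonoidHom.mulSingle (fun _ : ι => S) i) = ⊤ := by
      refine hn.eq_bot_or_eq_top.resolve_left fun h => hwi ?_
      rw [← Subgroup.mem_bot, ← hcenter, Subgroup.mem_center_iff]
      intro t
      -- The commutator of `w` with an element of the `i`-th factor lies in that factor and in `W`.
      have hmem : w i * t * (w i)⁻¹ * t⁻¹ ∈ W.comap (MonoidHom.mulSingle (fun _ : ι => S) i) := by
        have heq : Pi.mulSingle i (w i * t * (w i)⁻¹ * t⁻¹) =
            w * (Pi.mulSingle i t * w⁻¹ * (Pi.mulSingle i t)⁻¹ : ι → S) := by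
          funext k
          by_cases hk : k = i
          · subst hk
            simp [mul_assoc]
          · simp [Pi.mulSingle_eq_of_ne hk]
        change Pi.mulSingle i (w i * t * (w i)⁻¹ * t⁻¹) ∈ W
        rw [heq]
        exact mul_mem hw (hW.conj_mem _ (inv_mem hw) _)
      rw [h, Subgroup.mem_bot] at hmem
      exact ((mul_inv_eq_iff_eq_mul.1 (mul_inv_eq_one.1 hmem))).symm
    have : s ∈ W.comap (MonoidHom.mulSingle (fun _ : ι => S) i) := htop ▸ Subgroup.mem_top s
    exact this
  let r : W →* (J → S) :=
    { toFun := fun w i => w.1 i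
      map_one' := rfl
      map_mul' := fun _ _ => rfl }
  have hr : Function.Bijective r := by
    constructor
    · rw [injective_iff_map_eq_one]
      intro w hw
      ext i
      by_cases hi : i ∈ J
      · exact congrFun hw ⟨i, hi⟩
      · by_contra hne
        exact hi ⟨w, w.2, hne⟩
    · intro f
      refine ⟨⟨fun i => if hi : i ∈ J then f ⟨i, hi⟩ else 1,
        Subgroup.pi_mem_of_mulSingle_mem _ fun i => ?_⟩, ?_⟩
      · by_cases hi : i ∈ J
        · exact hsingle i hi _
        · simp [hi]
      · funext i
        simp [r]
  obtain ⟨k, ⟨σ⟩⟩ := Finite.exists_equiv_fin J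
  exact ⟨k, ⟨(MulEquiv.ofBijective r hr).trans (MulEquiv.arrowCongr σ (MulEquiv.refl S))⟩⟩

/-! ### Normal heredity of `X(R)` -/

namespace ChiefFactor

/-- The rank of a chief factor of `N` in a chief factor of `G` of non-abelian type divides the rank
of the latter. -/
theorem LiesIn.exists_isSimplePower {G : Type u} [Group G] [Finite G] {N : Subgroup G} [N.Normal]
    {d : ChiefFactor N} {c : ChiefFactor G} (h : d.LiesIn c) {S : Type u} [Group S] {n : ℕ}
    (hS : IsSimplePower S n c.Carrier) (hS' : ¬ IsMulCommutative S) :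
    ∃ k : ℕ, k ∣ n ∧ IsSimplePower S k d.Carrier := by
  have := hS.1
  have := hS.finite hS.ne_zero
  have hlt : c.bot.subgroupOf N < c.top.subgroupOf N :=
    lt_of_lt_of_le (lt_of_le_of_lt h.bot_le d.lt) h.le_top
  obtain ⟨m, hbot, htop⟩ := exists_bot_eq _ _ hlt
  have hm : m.LiesIn c := ⟨h.top_le, hbot.ge, htop⟩
  have hiso {d : ChiefFactor N} (hd : d.LiesIn c) := hm.nonempty_mulEquiv hbot hd
  obtain ⟨e⟩ := hS.2
  have hn := hm.normal_range_hom
  have hn' : (hm.hom.range.map e.toMonoidHom).Normal := hn.map _ e.surjective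
  obtain ⟨k, ⟨f⟩⟩ := exists_mulEquiv_pi_of_normal hS' (hm.hom.range.map e.toMonoidHom)
  have hker : m.bot.subgroupOf m.top = hm.hom.ker := by
    ext x
    rw [MonoidHom.mem_ker, hm.hom_eq_one_iff, Subgroup.mem_subgroupOf, hbot]
  let f' : m.Carrier ≃* (Fin k → S) :=
    (((QuotientGroup.quotientMulEquivOfEq hker).trans
      (QuotientGroup.quotientKerEquivRange hm.hom)).trans
      (e.subgroupMap hm.hom.range)).trans f
  obtain ⟨g⟩ := hiso h
  refine ⟨k, ?_, hS.1, ⟨g.trans f'⟩⟩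
  obtain ⟨j, hj⟩ := exists_card_eq_mul_pow (q := Nat.card m.Carrier) (c.top.subgroupOf N)
    inferInstance hlt.le fun e h₁ h₂ => by
      obtain ⟨g⟩ := hiso (d := e) ⟨h.top_le, h₁, h₂⟩
      exact Nat.card_congr g.toEquiv
  rw [Nat.card_congr (Subgroup.subgroupOfEquivOfLe h.top_le).toEquiv,
    Nat.card_congr (Subgroup.subgroupOfEquivOfLe (c.lt.le.trans h.top_le)).toEquiv, c.card_top,
    mul_comm, Nat.mul_right_inj Nat.card_pos.ne', Nat.card_congr e.toEquiv,
    Nat.card_congr f'.toEquiv, Nat.card_fun, Nat.card_fun, Nat.card_fin, Nat.card_fin,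
    ← pow_mul] at hj
  exact ⟨j, Nat.pow_right_injective Finite.one_lt_card hj⟩

theorem LiesIn.isAdmissible {G : Type u} [Group G] [Finite G] {N : Subgroup G} [N.Normal]
    {X : GroupClass.{u}} (hX : IsFormation X) (hN : nilpotentGroups.Subclass X)
    (hX' : IsNormallyHereditary X) {R : GeneralizedRankFunction.{u}} (hR : R.IsGood)
    {d : ChiefFactor N} {c : ChiefFactor G} (h : d.LiesIn c) (hc : c.IsAdmissible X R) :
    d.IsAdmissible X R := by
  intro hd
  obtain ⟨hXc, hrank⟩ := hc fun hc' => hd (h.isCentral hX hX' hc')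
  have key {n : ℕ} (hn : c.HasRank n) : ∃ (S : Type u) (_ : Group S) (k : ℕ), k ∣ n ∧
      IsSimpleGroup S ∧ Finite S ∧ ¬ X d.Carrier ∧ d.HasRank k ∧
      R.A c.Carrier = R.A S ∧ R.B c.Carrier = R.B S ∧
      R.A d.Carrier = R.A S ∧ R.B d.Carrier = R.B S := by
    obtain ⟨S, _, hS⟩ := hn
    have hfin := hS.finite hS.ne_zero
    have hXS : ¬ X S := fun hXS => by
      obtain ⟨e⟩ := hS.2
      have : Nonempty (Fin n) := ⟨⟨0, Nat.pos_of_ne_zero hS.ne_zero⟩⟩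
      exact hXc (hX.mulEquiv e.symm (hX.pi hXS))
    have hcomm : ¬ IsMulCommutative S := fun hcomm => hXS (hN S ⟨hfin, by
      let _ : CommGroup S := { ‹Group S› with mul_comm := hcomm.is_comm.comm }
      exact CommGroup.isNilpotent⟩)
    obtain ⟨k, hk, hSk⟩ := h.exists_isSimplePower hS hcomm
    have hcR := R.eq_of_power S c.Carrier n hS.ne_zero hS
    have hdR := R.eq_of_power S d.Carrier k hSk.ne_zero hSk
    refine ⟨S, _, k, hk, hS.1, hfin, fun hXd => hXS ?_, ⟨S, _, hSk⟩, hcR.1, hcR.2, hdR⟩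
    obtain ⟨e⟩ := hSk.2
    exact hX.image _ _ (Pi.evalMonoidHom (fun _ => S) ⟨0, Nat.pos_of_ne_zero hSk.ne_zero⟩)
      (Function.surjective_eval _) (hX.mulEquiv e hXd)
  rcases hrank with ⟨n, hnA, hn⟩ | ⟨⟨n, hnB, hn⟩, hi⟩
  · obtain ⟨S, _, k, hk, hS, _, hXd, hdk, hcA, -, hdA, -⟩ := key hn
    rw [hcA] at hnA
    exact ⟨hXd, Or.inl ⟨k, hdA ▸ (hR S hS).1 n hnA k hk, hdk⟩⟩
  · obtain ⟨S, _, k, hk, hS, _, hXd, hdk, -, hcB, hdA, hdB⟩ := key hn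
    rw [hcB] at hnB
    refine ⟨hXd, ?_⟩
    rcases (hR S hS).2 n hnB k hk with hA | hB
    · exact Or.inl ⟨k, hdA ▸ hA, hdk⟩
    · exact Or.inr ⟨⟨k, hdB ▸ hB, hdk⟩, h.inducesInner hi⟩

end ChiefFactor

theorem isNormallyHereditary_withRank {X : GroupClass.{u}} (hX : IsFormation X)
    (hN : nilpotentGroups.Subclass X) (hX' : IsNormallyHereditary X)
    {R : GeneralizedRankFunction.{u}} (hR : R.IsGood) : IsNormallyHereditary (X.withRank R) := by
  intro G _ N _ hG
  have := hG.1
  refine ⟨inferInstance, fun d => ?_⟩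
  obtain ⟨c, d', hdd', h⟩ := d.exists_similar_liesIn
  exact hdd'.isAdmissible hX (h.isAdmissible hX hN hX' hR (hG.2 c))

end CompositionFormation

theorem theorem1 (𝔉 : CompositionFormation.GroupClass.{u})
    (F : CompositionFormation.CompositionFunction.{u})
    (h𝔉 : CompositionFormation.IsCompositionFormation 𝔉)
    (hN : CompositionFormation.nilpotentGroups.Subclass 𝔉)
    (hF : CompositionFormation.IsCanonicalDefinition F 𝔉)
    (R : CompositionFormation.GeneralizedRankFunction.{u}) :
    (CompositionFormation.IsCompositionFormation (𝔉.withRank R) ∧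
      CompositionFormation.IsCanonicalDefinition ⟨𝔉.withRank R, F.prime⟩ (𝔉.withRank R) ∧
      (∀ D : CompositionFormation.CompositionFunction.{u},
        CompositionFormation.IsCanonicalDefinition D (𝔉.withRank R) →
          D = ⟨𝔉.withRank R, F.prime⟩)) ∧
    (CompositionFormation.IsNormallyHereditary 𝔉 → R.IsGood →
      CompositionFormation.IsNormallyHereditary (𝔉.withRank R)) := by
  have hcan := CompositionFormation.isCanonicalDefinition_withRank h𝔉.1 hN hF R
  exact ⟨⟨⟨hcan.isCompositionDefinition.1, _, hcan.isCompositionDefinition, hcan.eq_clf⟩, hcan,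
    fun D hD => hD.unique hcan⟩,
    fun hhered hR => CompositionFormation.isNormallyHereditary_withRank h𝔉.1 hN hhered hR⟩
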